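/- Let $h=(h_k)_{k\ge 0}$ be an offspring distribution with mean $m_h=\sum_k k h_k$ satisfying $0<m_h<1$, and suppose that there is $c>0$ with $\sum_{l\ge k}h_l\le e^{-ck}$ for every $k\in\mathbb N$. Let $\nu$ be a probability measure whose support is contained in $[q,Q]$ for some $1<q<Q$, and such that the $\mathbb Z$-linear span of $\log(\operatorname{supp}\nu)$ is dense in $\mathbb R$. Let $\mathbb P_h$ be the law of the ordered Galton–Watson tree $T$ with offspring distribution $h$, and let $\mathbb P_{h,\nu}$ be the law of this tree with biases $\beta_e$ attached to its edges $e$ that are independent of each other and of $T$ and have law $\nu$. For a vertex $v$ of $T$ let $\omega(v)$ be the product of the biases of the edges on the path from the root to $v$; let $D(T)$ be the depth of $T$, i.e. the maximal distance of a vertex from the root, and let $v_{\rm base}$ be the lexicographically minimal vertex among the vertices of $T$ at distance $D(T)$ from the root. Then there is a unique $\chi>0$ with $\int_1^\infty y^\chi\,\nu(dy)=1/m_h$, the limit $$\alpha=\lim_{n\to\infty} m_h^{-n}\,\mathbb P_h\big(D(T)=n\big)$$ exists and lies in $(0,\infty)$, and, as $u\to\infty$, $$\mathbb P_{h,\nu}\big(\omega(v_{\rm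 base})>u\big)\sim d_2\,u^{-\chi},\qquad d_2=\frac{\alpha}{\chi\, m_h\int_1^\infty y^\chi\log y\,d\nu(y)},$$ where $A(u)\sim B(u)$ means $A(u)/B(u)\to 1$. -/

import Mathlib

open Set Filter Topology MeasureTheory

/-- Labels (finite words) coding the vertices of ordered rooted trees: `[]` is the root and
`v ++ [i]` is the `(i + 1)`-st child of `v` (children are numbered from `0`). The generation
of `v`, i.e. its distance from the root, is `v.length`. -/
abbrev Label : Type := List ℕ

/-- The vertex set of the tree in which, for every vertex `v`, the number of offspring of `v`
is `K v`: a word belongs to it if each of its letters is less than the number of offspring of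
the vertex coded by the preceding letters. -/
def treeOf (K : Label → ℕ) : Set Label :=
  {v | ∀ (j : ℕ) (hj : j < v.length), v[j] < K (v.take j)}

/-- The depth of a tree: the supremum of the distances of its vertices from the root. -/
noncomputable def depth (T : Set Label) : ℕ∞ := ⨆ v ∈ T, (v.length : ℕ∞)

/-- `v` is the lexicographically minimal vertex among the vertices of `T` of maximal depth.
(The order `≤` on `List ℕ` is the lexicographic one.) -/
def IsBase (T : Set Label) (v : Label) : Prop :=
  v ∈ T ∧ (∀ w ∈ T, w.length ≤ v.length) ∧ ∀ w ∈ T, w.length = v.length → v ≤ w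

theorem IsBase.unique {T : Set Label} {v w : Label} (hv : IsBase T v) (hw : IsBase T w) :
    v = w := by
  have h : v.length = w.length := le_antisymm (hw.2.1 v hv.1) (hv.2.1 w hw.1)
  exact le_antisymm (hv.2.2 w hw.1 h.symm) (hw.2.2 v hv.1 h)

theorem IsBase.exists_of_finite {T : Set Label} (hT : T.Finite) (hne : T.Nonempty) :
    ∃ v, IsBase T v := by
  obtain ⟨m, hm, hmax⟩ := Set.exists_max_image T List.length hT hne
  obtain ⟨v, hv, hmin⟩ := Set.exists_min_image {w ∈ T | w.length = m.length} id
    (hT.subset (Set.sep_subset _ _)) ⟨m, hm, rfl⟩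
  refine ⟨v, hv.1, fun w hw => ?_, fun w hw h => hmin w ⟨hw, h.trans hv.2⟩⟩
  rw [hv.2]
  exact hmax w hw

open Classical in
/-- The base vertex of a tree: the lexicographically minimal vertex of maximal depth. It exists
for every finite tree; the value for trees that have no vertex of maximal depth is irrelevant. -/
noncomputable def vBase (T : Set Label) : Label :=
  if h : ∃ v, IsBase T v then h.choose else []

theorem isBase_vBase {T : Set Label} (hT : T.Finite) (hne : T.Nonempty) :
    IsBase T (vBase T) := by
  have h := IsBase.exists_of_finite hT hne
  rw [vBase, dif_pos h]
  exact h.choose_spec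

/-- The weight of a vertex: the product of the biases along the path from the root to it, where
`β u` is the bias of the edge between `u` and its parent, for `u` other than the root. -/
noncomputable def vertexWeight (β : Label → ℝ) (v : Label) : ℝ :=
  ∏ j ∈ Finset.range v.length, β (v.take (j + 1))

/-- The mean number of offspring. -/
noncomputable def offspringMean (h : PMF ℕ) : ENNReal := ∑' k : ℕ, (k : ENNReal) * h k

/-- The Galton-Watson law, given as the joint law of independent `h`-distributed offspring
numbers `K u`, one for each label `u`; the random tree is `treeOf K`. -/
noncomputable def gwLaw (h : PMF ℕ) : Measure (Label → ℕ) :=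
  Measure.infinitePi fun _ => h.toMeasure

/-- The law of the randomly biased Galton-Watson tree: the offspring numbers are distributed
according to `gwLaw h` and, independently of them, the biases `β u` are independent with
law `ν`. -/
noncomputable def biasedGWLaw (h : PMF ℕ) (ν : Measure ℝ) [IsProbabilityMeasure ν] :
    Measure ((Label → ℕ) × (Label → ℝ)) :=
  (gwLaw h).prod (Measure.infinitePi fun _ => ν)

/-!
The tree and the biases are independent, so conditionally on the tree the weight of the base vertex
is a product of `D(T)` independent `ν`-distributed factors: the base vertex depends on the offspring
numbers alone, and the biases along the path to a fixed label are i.i.d. Hence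
`P(ω(v_base) > u) = ∑ₙ P(D = n) P(Y₁ ⋯ Yₙ > u)` (`biasedGWLaw_vBase`).

*The depth.* The probability `qₙ` that generation `n` is nonempty satisfies
`qₙ₊₁ = 1 - f(1 - qₙ)`, with `f` the generating function of the offspring law
(`survivalProb_succ`). As `m s - C s² ≤ 1 - f(1 - s) ≤ m s` with `C` the second moment, `qₙ / mⁿ`
decreases to a positive limit `r` (`exists_tendsto_div_pow`), and
`P(D = n) = qₙ - qₙ₊₁ ~ r (1 - m) mⁿ`, so that `α = r (1 - m)`.

*The products.* Since the factors are at most `Q`, only large `n` matter when `u` is large, and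
`P(D = n)` may be replaced by `α mⁿ` (`weighted_sum_tendsto`). There remains
`G(t) = ∑ₙ mⁿ P(log Y₁ + ⋯ + log Yₙ > t)`. With `F` the law of `log y` under the probability measure
`m y^χ ν(dy)`, the function `Z(t) = exp(χ t) G(t)` satisfies `Z(t) = ∫ Z(t - x) F(dx)` for
`t ≥ 0`, and `Z(t) = exp(χ t) / (1 - m)` for `t < 0`.

*Renewal theory.* `F` lives on a compact interval in `(0, ∞)`, and convergence of `Z` is proved by
a maximum principle (`renewal_tendsto_exists`). Where `Z(t)` is close to its limit superior `L`, so
is `Z(t - s)` for some `s` near any prescribed element of the additive semigroup generated by the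
support of `F`. The non-lattice assumption makes this semigroup eventually `δ`-dense for
every `δ > 0` (`exists_addSubmonoid_near`). Because `G` is antitone, `Z` cannot increase quickly, so
`Z` is close to `L` on a whole interval as long as the memory of the equation, and hence, by the
minimum principle, forever after. The limit is identified by a conservation law: the integral
`∫ (∫_{t-x}^t Z) F(dx)` does not depend on `t ≥ 0` (`renewal_conservation`); it is `1 / χ` at
`t = 0`, and it tends to `L ∫ x F(dx)`.
-/

/-! ### Renewal theory -/

/-- The additive semigroup generated by a set of positive numbers comes within `δ` of every large
number, as soon as the generated group is dense: if `r` and `r + g` belong to the semigroup, with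
`0 < g < δ`, then so do all `N r + k g` with `k ≤ N`. -/
theorem exists_addSubmonoid_near {S : Set ℝ} (hpos : ∀ x ∈ S, 0 < x)
    (hd : Dense (AddSubgroup.closure S : Set ℝ)) {δ : ℝ} (hδ : 0 < δ) :
    ∃ Y : ℝ, ∀ y, Y ≤ y → ∃ s ∈ AddSubmonoid.closure S, |s - y| < δ := by
  have hdiff : ∀ g ∈ AddSubgroup.closure S, ∃ p ∈ AddSubmonoid.closure S,
      ∃ r ∈ AddSubmonoid.closure S, g = p - r := by
    intro g hg
    induction hg using AddSubgroup.closure_induction with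
    | mem x hx => exact ⟨x, AddSubmonoid.subset_closure hx, 0, zero_mem _, by simp⟩
    | zero => exact ⟨0, zero_mem _, 0, zero_mem _, by simp⟩
    | add x y _ _ hx hy =>
      obtain ⟨p, hp, r, hr, rfl⟩ := hx
      obtain ⟨p', hp', r', hr', rfl⟩ := hy
      exact ⟨p + p', add_mem hp hp', r + r', add_mem hr hr', by ring⟩
    | neg x _ hx =>
      obtain ⟨p, hp, r, hr, rfl⟩ := hx
      exact ⟨r, hr, p, hp, by ring⟩
  have hnonneg : ∀ s ∈ AddSubmonoid.closure S, 0 ≤ s := by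
    intro s hs
    induction hs using AddSubmonoid.closure_induction with
    | mem x hx => exact (hpos x hx).le
    | zero => exact le_rfl
    | add x y _ _ hx hy => exact add_nonneg hx hy
  obtain ⟨g, hgmem, hg0, hgδ⟩ : ∃ g ∈ AddSubgroup.closure S, 0 < g ∧ g < δ := by
    obtain ⟨g, hg, hg'⟩ := hd.exists_mem_open isOpen_Ioo (nonempty_Ioo.2 hδ)
    exact ⟨g, hg, hg'⟩
  obtain ⟨x, hx⟩ : S.Nonempty := by
    rw [nonempty_iff_ne_empty]
    rintro rfl
    simp only [AddSubgroup.closure_empty, AddSubgroup.mem_bot] at hgmem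
    exact hg0.ne' hgmem
  -- adding a generator to both terms of the difference `g` makes the subtrahend positive
  obtain ⟨r, hr, hr0, hrg⟩ : ∃ r ∈ AddSubmonoid.closure S, 0 < r ∧
      r + g ∈ AddSubmonoid.closure S := by
    obtain ⟨p, hp, r, hr, rfl⟩ := hdiff g hgmem
    have hx' := AddSubmonoid.subset_closure hx
    refine ⟨r + x, add_mem hr hx', by linarith [hnonneg r hr, hpos x hx], ?_⟩
    convert add_mem hp hx' using 1
    ring
  -- from `N₀` on, the progressions `N r + k g`, `k ≤ N`, for consecutive `N` leave no gaps
  obtain ⟨N₀, hN₀⟩ := exists_nat_gt (r / g)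
  refine ⟨N₀ * r, fun y hy => ?_⟩
  have hy0 : 0 ≤ y := le_trans (by positivity) hy
  set N := ⌊y / r⌋₊ with hN
  have hN1 : (N : ℝ) * r ≤ y := by
    have := Nat.floor_le (div_nonneg hy0 hr0.le)
    rwa [le_div_iff₀ hr0] at this
  have hN2 : y < (N + 1) * r := by
    have := Nat.lt_floor_add_one (y / r)
    rwa [div_lt_iff₀ hr0] at this
  have hNN : N₀ ≤ N := Nat.le_floor (by rwa [le_div_iff₀ hr0])
  set k := ⌊(y - N * r) / g⌋₊ with hk
  have hθ : 0 ≤ y - N * r := by linarith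
  have hk1 : (k : ℝ) * g ≤ y - N * r := by
    have := Nat.floor_le (div_nonneg hθ hg0.le)
    rwa [le_div_iff₀ hg0] at this
  have hk2 : y - N * r < (k + 1) * g := by
    have := Nat.lt_floor_add_one ((y - N * r) / g)
    rwa [div_lt_iff₀ hg0] at this
  have hkN : k ≤ N := by
    have h1 : r < N₀ * g := by rwa [div_lt_iff₀ hg0] at hN₀
    have h2 : (N₀ : ℝ) ≤ N := by exact_mod_cast hNN
    have h3 : (k : ℝ) * g < N * g := by nlinarith
    have h4 := lt_of_mul_lt_mul_right h3 hg0.le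
    exact (by exact_mod_cast h4 : k < N).le
  refine ⟨k • (r + g) + (N - k) • r,
    add_mem (nsmul_mem hrg _) (nsmul_mem hr _), ?_⟩
  simp only [nsmul_eq_mul]
  push_cast [Nat.cast_sub hkN]
  rw [abs_lt]
  constructor <;> nlinarith

section Renewal

variable {F : Measure ℝ} [IsProbabilityMeasure F] {a b : ℝ} {Z : ℝ → ℝ}

/-- The maximum principle for the homogeneous renewal equation `Z t = ∫ Z (t - x) F(dx)`, `t ≥ w`. -/
theorem renewal_le (ha : 0 < a) (hF : ∀ᵐ x ∂F, x ∈ Icc a b)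
    (hZ0 : ∀ t, 0 ≤ Z t) {w B : ℝ} (hB : ∀ t, w - b ≤ t → t < w → Z t ≤ B)
    (heq : ∀ t, w ≤ t → Z t = ∫ x, Z (t - x) ∂F) (t : ℝ) (ht : w - b ≤ t) : Z t ≤ B := by
  have key : ∀ n : ℕ, ∀ t, w - b ≤ t → t < w + n * a → Z t ≤ B := by
    intro n
    induction n with
    | zero => intro t h1 h2; exact hB t h1 (by simpa using h2)
    | succ n ih =>
      intro t h1 h2
      rcases lt_or_ge t w with h | h
      · exact hB t h1 h
      rw [heq t h]
      calc ∫ x, Z (t - x) ∂F ≤ ∫ _, B ∂F := by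
            refine integral_mono_of_nonneg (Eventually.of_forall fun x => hZ0 _)
              (integrable_const _) ?_
            filter_upwards [hF] with x hx
            refine ih _ (by linarith [hx.2]) ?_
            push_cast at h2
            linarith [hx.1]
        _ = B := by simp
  obtain ⟨n, hn⟩ := exists_nat_gt ((t - w) / a)
  rw [div_lt_iff₀ ha] at hn
  exact key n t ht (by linarith)

/-- The minimum principle for the homogeneous renewal equation. Integrability is assumed here, since
the integral of a non-integrable function is `0` by convention; in `renewal_le` that value does no
harm. -/
theorem le_renewal (ha : 0 < a) (hF : ∀ᵐ x ∂F, x ∈ Icc a b)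
    {w ℓ : ℝ} (hB : ∀ t, w - b ≤ t → t < w → ℓ ≤ Z t)
    (hint : ∀ t, w ≤ t → Integrable (fun x => Z (t - x)) F)
    (heq : ∀ t, w ≤ t → Z t = ∫ x, Z (t - x) ∂F) (t : ℝ) (ht : w - b ≤ t) : ℓ ≤ Z t := by
  have key : ∀ n : ℕ, ∀ t, w - b ≤ t → t < w + n * a → ℓ ≤ Z t := by
    intro n
    induction n with
    | zero => intro t h1 h2; exact hB t h1 (by simpa using h2)
    | succ n ih =>
      intro t h1 h2
      rcases lt_or_ge t w with h | h
      · exact hB t h1 h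
      rw [heq t h]
      calc ℓ = ∫ _, ℓ ∂F := by simp
        _ ≤ ∫ x, Z (t - x) ∂F := by
            refine integral_mono_ae (integrable_const _) (hint t h) ?_
            filter_upwards [hF] with x hx
            refine ih _ (by linarith [hx.2]) ?_
            push_cast at h2
            linarith [hx.1]
  obtain ⟨n, hn⟩ := exists_nat_gt ((t - w) / a)
  rw [div_lt_iff₀ ha] at hn
  exact key n t ht (by linarith)

/-- Whenever `Z t` is close to `L` and `t` is large, `Z (t - s)` exceeds `L - ε` for some `s` close
to `y`. This is used with `L` the limit superior of `Z` at infinity. -/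
def NearMax (Z : ℝ → ℝ) (L y : ℝ) : Prop :=
  ∀ ε > 0, ∃ ε' > 0, ∃ T : ℝ, ∀ t ≥ T, L - ε' < Z t → ∃ s, |s - y| < ε ∧ L - ε < Z (t - s)

theorem NearMax.zero (Z : ℝ → ℝ) (L : ℝ) : NearMax Z L 0 := fun ε hε =>
  ⟨ε, hε, 0, fun t _ h => ⟨0, by simpa using hε, by simpa using h⟩⟩

theorem NearMax.add {L y₁ y₂ : ℝ} (h₁ : NearMax Z L y₁) (h₂ : NearMax Z L y₂) :
    NearMax Z L (y₁ + y₂) := by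
  intro ε hε
  obtain ⟨ε₂, hε₂, T₂, H₂⟩ := h₂ (ε / 2) (half_pos hε)
  obtain ⟨ε₁, hε₁, T₁, H₁⟩ := h₁ (min ε₂ (ε / 2)) (lt_min hε₂ (half_pos hε))
  refine ⟨ε₁, hε₁, max T₁ (T₂ + y₁ + ε), fun t ht h => ?_⟩
  obtain ⟨s₁, hs₁, hs₁'⟩ := H₁ t (le_trans (le_max_left _ _) ht) h
  have hm1 := min_le_left ε₂ (ε / 2)
  have hm2 := min_le_right ε₂ (ε / 2)
  have hT := le_trans (le_max_right _ _) ht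
  rw [abs_lt] at hs₁
  obtain ⟨s₂, hs₂, hs₂'⟩ := H₂ (t - s₁) (by linarith [hs₁.2]) (by linarith)
  rw [abs_lt] at hs₂
  refine ⟨s₁ + s₂, ?_, ?_⟩
  · rw [abs_lt]; constructor <;> linarith [hs₁.1, hs₁.2, hs₂.1, hs₂.2]
  · rw [← sub_sub]; linarith

/-- If every neighbourhood of `x` is charged by `F`, then `NearMax Z L x`: otherwise the average
`Z t = ∫ Z (t - y) F(dy)` would stay a fixed amount below `L`. -/
theorem nearMax_of_charged (hF : ∀ᵐ x ∂F, x ∈ Icc a b) {L x : ℝ}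
    (hub : ∀ ε > 0, ∃ T, ∀ t ≥ T, Z t < L + ε)
    (hint : ∀ t, 0 ≤ t → Integrable (fun x => Z (t - x)) F)
    (heq : ∀ t, 0 ≤ t → Z t = ∫ x, Z (t - x) ∂F)
    (hx : ∀ δ > 0, 0 < F (Metric.ball x δ)) : NearMax Z L x := by
  intro ε hε
  set p := F.real (Metric.ball x ε) with hp
  have hp0 : 0 < p := ENNReal.toReal_pos (hx ε hε).ne' (measure_ne_top _ _)
  have hη : 0 < p * ε / 2 := by positivity
  obtain ⟨T, hT⟩ := hub _ hη
  refine ⟨p * ε / 2, hη, max 0 (T + b), fun t ht h => ?_⟩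
  by_contra! hcon
  have ht0 : 0 ≤ t := le_trans (le_max_left _ _) ht
  have htT : T + b ≤ t := le_trans (le_max_right _ _) ht
  have hle : Z t ≤ ∫ y, ((L + p * ε / 2) -
      (Metric.ball x ε).indicator (fun _ => p * ε / 2 + ε) y) ∂F := by
    rw [heq t ht0]
    refine integral_mono_ae (hint t ht0) ((integrable_const _).sub
      ((integrable_const _).indicator measurableSet_ball)) ?_
    filter_upwards [hF] with y hy
    by_cases hyb : y ∈ Metric.ball x ε
    · rw [indicator_of_mem hyb]
      have := hcon y (by simpa [Real.dist_eq] using hyb)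
      linarith
    · rw [indicator_of_notMem hyb]
      have := hT (t - y) (by linarith [hy.2])
      linarith
  rw [integral_sub (integrable_const _) ((integrable_const _).indicator measurableSet_ball),
    integral_indicator_const _ measurableSet_ball] at hle
  simp only [integral_const, probReal_univ, one_mul, smul_eq_mul] at hle
  rw [← hp] at hle
  nlinarith [mul_pos hp0 hη]

theorem NearMax.finite {L : ℝ} (y : ℕ → ℝ) (hy : ∀ k, NearMax Z L (y k)) {ε : ℝ} (hε : 0 < ε)
    (K : ℕ) : ∃ ε' > 0, ∃ T : ℝ, ∀ t ≥ T, L - ε' < Z t →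
      ∀ k < K, ∃ s, |s - y k| < ε ∧ L - ε < Z (t - s) := by
  induction K with
  | zero => exact ⟨1, one_pos, 0, fun t _ _ k hk => absurd hk (Nat.not_lt_zero _)⟩
  | succ K ih =>
    obtain ⟨e₁, he₁, T₁, H₁⟩ := ih
    obtain ⟨e₂, he₂, T₂, H₂⟩ := hy K ε hε
    refine ⟨min e₁ e₂, lt_min he₁ he₂, max T₁ T₂, fun t ht h k hk => ?_⟩
    rcases Nat.lt_succ_iff_lt_or_eq.1 hk with hk | rfl
    · exact H₁ t ((le_max_left _ _).trans ht) (by linarith [min_le_left e₁ e₂]) k hk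
    · exact H₂ t ((le_max_right _ _).trans ht) (by linarith [min_le_right e₁ e₂])

/-- A bounded solution of the renewal equation with controlled growth converges at infinity. -/
theorem renewal_tendsto_exists {χ : ℝ} (hχ : 0 ≤ χ) (ha : 0 < a) (hF : ∀ᵐ x ∂F, x ∈ Icc a b)
    (hZm : Measurable Z) (hZ0 : ∀ t, 0 ≤ Z t) {B : ℝ} (hB : ∀ t, Z t ≤ B)
    (hZs : ∀ t s, 0 ≤ s → Z (t + s) ≤ Real.exp (χ * s) * Z t)
    (heq : ∀ t, 0 ≤ t → Z t = ∫ x, Z (t - x) ∂F)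
    {S : Set ℝ} (hS : ∀ x ∈ S, 0 < x) (hSF : ∀ x ∈ S, ∀ δ > 0, 0 < F (Metric.ball x δ))
    (hd : Dense (AddSubgroup.closure S : Set ℝ)) :
    ∃ L, Tendsto Z atTop (𝓝 L) := by
  have hint : ∀ t, Integrable (fun x => Z (t - x)) F := fun t =>
    Integrable.of_bound (hZm.comp (measurable_const.sub measurable_id)).aestronglyMeasurable B
      (Eventually.of_forall fun x => by
        rw [Real.norm_eq_abs, abs_of_nonneg (hZ0 _)]; exact hB _)
  have hbdd : IsBoundedUnder (· ≤ ·) atTop Z := isBoundedUnder_of ⟨B, hB⟩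
  have hcobdd : IsCoboundedUnder (· ≤ ·) atTop Z :=
    (isBoundedUnder_of ⟨0, hZ0⟩ : IsBoundedUnder (· ≥ ·) atTop Z).isCoboundedUnder_le
  set L := limsup Z atTop with hL
  have hub : ∀ ε > 0, ∃ T, ∀ t ≥ T, Z t < L + ε := fun ε hε =>
    eventually_atTop.1 (eventually_lt_of_limsup_lt (by linarith : limsup Z atTop < L + ε) hbdd)
  have hfreq : ∀ ε > 0, ∃ᶠ t in atTop, L - ε < Z t := fun ε hε =>
    frequently_lt_of_lt_limsup hcobdd (by linarith : L - ε < limsup Z atTop)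
  have hnear : ∀ y ∈ AddSubmonoid.closure S, NearMax Z L y := by
    intro y hy
    induction hy using AddSubmonoid.closure_induction with
    | mem x hx => exact nearMax_of_charged hF hub (fun t _ => hint t) heq (hSF x hx)
    | zero => exact NearMax.zero Z L
    | add x y _ _ hx hy => exact hx.add hy
  -- `Z` is almost `L` along an interval of length `b`, hence beyond it by the minimum principle;
  -- the factor is the price for filling gaps of length `6 ε` by the growth bound `hZs`
  have hlow : ∀ ε > 0, ∃ T, ∀ t ≥ T, Real.exp (-(χ * (6 * ε))) * (L - ε) ≤ Z t := by
    intro ε hε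
    obtain ⟨Y, hY⟩ := exists_addSubmonoid_near hS hd hε
    have hYk : ∀ k : ℕ, ∃ s ∈ AddSubmonoid.closure S, |s - (Y + k * ε)| < ε := fun k =>
      hY _ (by have : 0 ≤ (k : ℝ) * ε := by positivity
               linarith)
    choose y hyS hy using hYk
    obtain ⟨K, hK⟩ := exists_nat_gt (b / ε + 4)
    obtain ⟨ε', hε', T, H⟩ := NearMax.finite y (fun k => hnear _ (hyS k)) hε K
    obtain ⟨t, hZt, htT⟩ := ((hfreq ε' hε').and_eventually
      (eventually_ge_atTop (max T (Y + 3 * ε + b)))).exists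
    have ht1 : T ≤ t := (le_max_left _ _).trans htT
    have ht2 : Y + 3 * ε + b ≤ t := (le_max_right _ _).trans htT
    refine ⟨t - Y - 3 * ε, fun t' ht' => ?_⟩
    refine le_renewal (w := t - Y - 3 * ε) ha hF ?_ (fun t _ => hint t)
      (fun s hs => heq s ?_) t' ?_
    · intro w hw1 hw2
      set k := ⌊(t - w - 3 * ε - Y) / ε⌋₊ with hk
      have h0 : 0 ≤ t - w - 3 * ε - Y := by linarith
      have hk1 : (k : ℝ) * ε ≤ t - w - 3 * ε - Y := by
        have := Nat.floor_le (div_nonneg h0 hε.le)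
        rwa [le_div_iff₀ hε] at this
      have hk2 : t - w - 3 * ε - Y < (k + 1) * ε := by
        have := Nat.lt_floor_add_one ((t - w - 3 * ε - Y) / ε)
        rwa [div_lt_iff₀ hε] at this
      have hkK : k < K := by
        have h1 : b + 4 * ε < K * ε := by
          have := mul_lt_mul_of_pos_right hK hε
          rwa [add_mul, div_mul_cancel₀ _ hε.ne'] at this
        have h2 : (k : ℝ) * ε < K * ε := by linarith
        exact_mod_cast lt_of_mul_lt_mul_right h2 hε.le
      obtain ⟨s, hs, hs'⟩ := H t ht1 hZt k hkK
      have hyk := hy k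
      rw [abs_lt] at hs hyk
      have hr0 : 0 ≤ t - s - w := by linarith [hs.2, hyk.2]
      have hr1 : t - s - w ≤ 6 * ε := by linarith [hs.1, hyk.1]
      have h3 := hZs w (t - s - w) hr0
      rw [add_sub_cancel] at h3
      have h4 : Real.exp (χ * (t - s - w)) ≤ Real.exp (χ * (6 * ε)) :=
        Real.exp_le_exp.2 (mul_le_mul_of_nonneg_left hr1 hχ)
      have h5 : L - ε ≤ Real.exp (χ * (6 * ε)) * Z w :=
        hs'.le.trans (h3.trans (mul_le_mul_of_nonneg_right h4 (hZ0 w)))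
      calc Real.exp (-(χ * (6 * ε))) * (L - ε)
          ≤ Real.exp (-(χ * (6 * ε))) * (Real.exp (χ * (6 * ε)) * Z w) :=
            mul_le_mul_of_nonneg_left h5 (Real.exp_pos _).le
        _ = Z w := by rw [← mul_assoc, ← Real.exp_add]; simp
    · have hab : a ≤ b := by
        obtain ⟨x, hx⟩ := hF.exists
        exact hx.1.trans hx.2
      linarith
    · have hab : a ≤ b := by
        obtain ⟨x, hx⟩ := hF.exists
        exact hx.1.trans hx.2
      linarith
  refine ⟨L, tendsto_order.2 ⟨fun l hl => ?_, fun u hu => ?_⟩⟩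
  · have hc : Tendsto (fun ε : ℝ => Real.exp (-(χ * (6 * ε))) * (L - ε)) (𝓝[>] 0) (𝓝 L) := by
      have : Continuous (fun ε : ℝ => Real.exp (-(χ * (6 * ε))) * (L - ε)) := by fun_prop
      have h := this.tendsto 0
      simp only [mul_zero, neg_zero, Real.exp_zero, sub_zero, one_mul] at h
      exact h.mono_left nhdsWithin_le_nhds
    obtain ⟨ε, hε1, hε2⟩ := ((hc.eventually (lt_mem_nhds hl)).and
      self_mem_nhdsWithin).exists
    obtain ⟨T, hT⟩ := hlow ε hε2
    exact eventually_atTop.2 ⟨T, fun t ht => hε1.trans_le (hT t ht)⟩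
  · obtain ⟨T, hT⟩ := hub (u - L) (by linarith)
    exact eventually_atTop.2 ⟨T, fun t ht => by linarith [hT t ht]⟩


theorem intervalIntegrable_of_bound (hZm : Measurable Z) {B : ℝ} (hB : ∀ s, ‖Z s‖ ≤ B)
    (u v : ℝ) : IntervalIntegrable Z volume u v :=
  (intervalIntegrable_const (c := B)).mono_fun hZm.aestronglyMeasurable
    (Eventually.of_forall fun s => (hB s).trans (le_abs_self B))

/-- The conserved quantity of the homogeneous renewal equation. -/
theorem renewal_conservation (hF : ∀ᵐ x ∂F, x ∈ Icc a b)
    (hZm : Measurable Z) (hZ0 : ∀ t, 0 ≤ Z t) {B : ℝ} (hB : ∀ t, Z t ≤ B)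
    (heq : ∀ t, 0 ≤ t → Z t = ∫ x, Z (t - x) ∂F) {t : ℝ} (ht : 0 ≤ t) :
    ∫ x, (∫ s in (t - x)..t, Z s) ∂F = ∫ x, (∫ s in (-x)..0, Z s) ∂F := by
  have hbound : ∀ s, ‖Z s‖ ≤ B := fun s => by
    rw [Real.norm_eq_abs, abs_of_nonneg (hZ0 _)]; exact hB _
  have hii := intervalIntegrable_of_bound hZm hbound
  set A : ℝ → ℝ := fun t => ∫ s in (0 : ℝ)..t, Z s with hA
  have hAc : Continuous A := intervalIntegral.continuous_primitive hii 0
  have hAsub : ∀ u v, ∫ s in u..v, Z s = A v - A u := fun u v =>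
    (intervalIntegral.integral_interval_sub_left (hii 0 v) (hii 0 u)).symm
  have hAint : ∀ u, Integrable (fun x => A (u - x)) F := by
    intro u
    obtain ⟨C, hC⟩ := (isCompact_Icc (a := a) (b := b)).exists_bound_of_continuousOn
      (f := fun x => A (u - x)) (by fun_prop)
    exact Integrable.of_bound (Continuous.aestronglyMeasurable (by fun_prop)) C
      (hF.mono fun x hx => hC x hx)
  have hswap : A t = ∫ x, (A (t - x) - A (0 - x)) ∂F := by
    calc A t = ∫ s in (0 : ℝ)..t, ∫ x, Z (s - x) ∂F := by
          refine intervalIntegral.integral_congr fun s hs => ?_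
          rw [uIcc_of_le ht] at hs
          exact heq s hs.1
      _ = ∫ s in Ioc 0 t, ∫ x, Z (s - x) ∂F := intervalIntegral.integral_of_le ht
      _ = ∫ x, (∫ s in Ioc 0 t, Z (s - x)) ∂F := by
          refine integral_integral_swap (f := fun s x => Z (s - x)) ?_
          refine Integrable.of_bound (C := B) ?_ (Eventually.of_forall fun p => hbound _)
          exact (hZm.comp (measurable_fst.sub measurable_snd)).aestronglyMeasurable
      _ = ∫ x, (A (t - x) - A (0 - x)) ∂F := by
          refine integral_congr_ae (Eventually.of_forall fun x => ?_)
          simp only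
          rw [← intervalIntegral.integral_of_le ht, intervalIntegral.integral_comp_sub_right,
            hAsub]
  rw [integral_sub (hAint t) (hAint 0)] at hswap
  have h0 : A 0 = 0 := intervalIntegral.integral_same
  simp only [hAsub]
  rw [integral_sub (integrable_const _) (hAint t), h0]
  simp only [zero_sub, integral_const, probReal_univ, one_smul, integral_neg] at hswap ⊢
  linarith

/-- The renewal theorem for non-lattice step laws on `[a, b]`, `0 < a`, in terms of the homogeneous
equation: the values of `Z` on the negative half-line serve as the initial condition. -/
theorem renewal_tendsto {χ : ℝ} (hχ : 0 ≤ χ) (ha : 0 < a) (hF : ∀ᵐ x ∂F, x ∈ Icc a b)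
    (hZm : Measurable Z) (hZ0 : ∀ t, 0 ≤ Z t) {B : ℝ} (hB : ∀ t < 0, Z t ≤ B)
    (hZs : ∀ t s, 0 ≤ s → Z (t + s) ≤ Real.exp (χ * s) * Z t)
    (heq : ∀ t, 0 ≤ t → Z t = ∫ x, Z (t - x) ∂F)
    {S : Set ℝ} (hS : ∀ x ∈ S, 0 < x) (hSF : ∀ x ∈ S, ∀ δ > 0, 0 < F (Metric.ball x δ))
    (hd : Dense (AddSubgroup.closure S : Set ℝ)) :
    Tendsto Z atTop (𝓝 ((∫ x, (∫ s in (-x)..0, Z s) ∂F) / ∫ x, x ∂F)) := by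
  have hab : a ≤ b := by
    obtain ⟨x, hx⟩ := hF.exists
    exact hx.1.trans hx.2
  have hB' : ∀ t, Z t ≤ B := fun t => by
    rcases lt_or_ge t 0 with h | h
    · exact hB t h
    · exact renewal_le ha hF hZ0 (w := 0) (fun t _ h => hB t h) heq t (by linarith)
  obtain ⟨L, hL⟩ := renewal_tendsto_exists hχ ha hF hZm hZ0 hB' hZs heq hS hSF hd
  have hxi : Integrable (fun x : ℝ => x) F :=
    Integrable.of_bound measurable_id.aestronglyMeasurable b (hF.mono fun x hx => by
      rw [Real.norm_eq_abs, abs_of_nonneg (ha.le.trans hx.1)]; exact hx.2)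
  have hmean : 0 < ∫ x, x ∂F := by
    refine ha.trans_le ?_
    calc a = ∫ _, a ∂F := by simp
      _ ≤ _ := integral_mono_ae (integrable_const _) hxi (hF.mono fun x hx => hx.1)
  have hii := intervalIntegrable_of_bound hZm fun s => by
    rw [Real.norm_eq_abs, abs_of_nonneg (hZ0 _)]; exact hB' s
  set C := ∫ x, (∫ s in (-x)..0, Z s) ∂F with hC
  have hclose : ∀ ε > 0, |C - ∫ x, L * x ∂F| ≤ ε * b := by
    intro ε hε
    obtain ⟨T, hT⟩ := eventually_atTop.1 (Metric.tendsto_nhds.1 hL ε hε)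
    set t := max 0 (T + b) with ht
    have ht0 : 0 ≤ t := le_max_left _ _
    have htT : T + b ≤ t := le_max_right _ _
    have hAc : Continuous fun x => ∫ s in (t - x)..t, Z s := by
      have h := intervalIntegral.continuous_primitive hii t
      have h2 : (fun x => ∫ s in (t - x)..t, Z s) = fun x => -∫ s in t..(t - x), Z s := by
        ext x; rw [intervalIntegral.integral_symm]
      rw [h2]
      exact (h.comp (continuous_const.sub continuous_id)).neg
    have hAi : Integrable (fun x => ∫ s in (t - x)..t, Z s) F := by
      obtain ⟨D, hD⟩ := (isCompact_Icc (a := a) (b := b)).exists_bound_of_continuousOn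
        hAc.continuousOn
      exact Integrable.of_bound hAc.aestronglyMeasurable D (hF.mono fun x hx => hD x hx)
    rw [hC, ← renewal_conservation hF hZm hZ0 hB' heq ht0,
      ← integral_sub hAi (hxi.const_mul L), ← Real.norm_eq_abs]
    have := norm_integral_le_of_norm_le_const (μ := F) (C := ε * b)
      (f := fun x => (∫ s in (t - x)..t, Z s) - L * x) ?_
    · simpa using this
    filter_upwards [hF] with x hx
    have hx0 : 0 ≤ x := ha.le.trans hx.1
    have e : (∫ s in (t - x)..t, Z s) - L * x = ∫ s in (t - x)..t, (Z s - L) := by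
      rw [intervalIntegral.integral_sub (hii _ _) intervalIntegrable_const]
      simp [mul_comm]
    rw [e]
    refine (intervalIntegral.norm_integral_le_of_norm_le_const (C := ε) fun s hs => ?_).trans ?_
    · rw [uIoc_of_le (by linarith)] at hs
      exact (hT s (by linarith [hs.1, hx.2])).le
    · rw [sub_sub_cancel, abs_of_nonneg hx0]
      exact mul_le_mul_of_nonneg_left hx.2 hε.le
  have hCL : C = L * ∫ x, x ∂F := by
    rw [integral_const_mul] at hclose
    have hlim : Tendsto (fun ε : ℝ => ε * b) (𝓝[>] 0) (𝓝 0) := by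
      have : Continuous (fun ε : ℝ => ε * b) := by fun_prop
      have h := this.tendsto 0
      rw [zero_mul] at h
      exact h.mono_left nhdsWithin_le_nhds
    have := ge_of_tendsto hlim (eventually_mem_nhdsWithin.mono fun ε hε => hclose ε hε)
    exact sub_eq_zero.1 (abs_nonpos_iff.1 this)
  rw [hCL, mul_div_cancel_right₀ _ hmean.ne']
  exact hL

end Renewal

/-! ### The depth of the Galton-Watson tree -/

theorem nil_mem_treeOf (K : Label → ℕ) : [] ∈ treeOf K := by simp [treeOf]

theorem cons_mem_treeOf {K : Label → ℕ} {i : ℕ} {v : Label} :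
    i :: v ∈ treeOf K ↔ i < K [] ∧ v ∈ treeOf (fun w => K (i :: w)) := by
  constructor
  · intro h
    exact ⟨h 0 (by simp), fun j hj => h (j + 1) (by simpa using hj)⟩
  · rintro ⟨h0, h⟩ j hj
    cases j with
    | zero => simpa using h0
    | succ j => simpa using h j (by simpa using hj)

theorem take_mem_treeOf {K : Label → ℕ} {v : Label} (hv : v ∈ treeOf K) (n : ℕ) :
    v.take n ∈ treeOf K := by
  intro j hj
  have hj' : j < v.length := lt_of_lt_of_le hj (by simp)
  have hjn : j < n := lt_of_lt_of_le hj (by simp)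
  have := hv j hj'
  simpa [List.take_take, hjn.le, min_eq_left] using this

/-- The families of offspring numbers whose tree has a vertex of generation `n`. -/
def survives (n : ℕ) : Set (Label → ℕ) := {K | ∃ v ∈ treeOf K, v.length = n}

theorem survives_zero : survives 0 = univ :=
  eq_univ_of_forall fun K => ⟨[], nil_mem_treeOf K, rfl⟩

theorem mem_survives_succ {n : ℕ} {K : Label → ℕ} :
    K ∈ survives (n + 1) ↔ ∃ i < K [], (fun w => K (i :: w)) ∈ survives n := by
  constructor
  · rintro ⟨v, hv, hl⟩
    cases v with
    | nil => simp at hl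
    | cons i v =>
      obtain ⟨h1, h2⟩ := cons_mem_treeOf.1 hv
      exact ⟨i, h1, v, h2, by simpa using hl⟩
  · rintro ⟨i, hi, v, hv, hl⟩
    exact ⟨i :: v, cons_mem_treeOf.2 ⟨hi, hv⟩, by simp [hl]⟩

theorem exists_mem_treeOf_length {K : Label → ℕ} {v : Label} (hv : v ∈ treeOf K) {n : ℕ}
    (hn : n ≤ v.length) : K ∈ survives n :=
  ⟨v.take n, take_mem_treeOf hv n, by simpa using hn⟩

theorem survives_succ_subset (n : ℕ) : survives (n + 1) ⊆ survives n := by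
  rintro K ⟨v, hv, hl⟩
  exact exists_mem_treeOf_length hv (by omega)

theorem le_depth_iff {n : ℕ} {K : Label → ℕ} :
    (n : ℕ∞) ≤ depth (treeOf K) ↔ K ∈ survives n := by
  constructor
  · intro h
    by_contra hK
    cases n with
    | zero => simp [survives_zero] at hK
    | succ n =>
      have hle : depth (treeOf K) ≤ (n : ℕ∞) := by
        refine iSup₂_le fun v hv => ?_
        have : v.length < n + 1 := not_le.1 fun h => hK (exists_mem_treeOf_length hv h)
        exact_mod_cast Nat.lt_succ_iff.1 this
      have := h.trans hle
      norm_cast at this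
      omega
  · rintro ⟨v, hv, rfl⟩
    exact le_iSup₂ (f := fun v (_ : v ∈ treeOf K) => (v.length : ℕ∞)) v hv

theorem depth_eq_iff {n : ℕ} {K : Label → ℕ} :
    depth (treeOf K) = n ↔ K ∈ survives n \ survives (n + 1) := by
  rw [Set.mem_sdiff, ← le_depth_iff, ← le_depth_iff]
  constructor
  · intro h
    rw [h]
    refine ⟨le_rfl, ?_⟩
    norm_cast
    omega
  · rintro ⟨h1, h2⟩
    refine le_antisymm ?_ h1
    rw [not_le] at h2
    push_cast at h2
    exact (ENat.lt_add_one_iff (by simp)).1 h2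

theorem measurableSet_mem_treeOf (v : Label) : MeasurableSet {K : Label → ℕ | v ∈ treeOf K} := by
  have : {K : Label → ℕ | v ∈ treeOf K} =
      ⋂ (j : ℕ) (hj : j < v.length), {K | v[j] < K (v.take j)} := by
    ext K; simp [treeOf]
  rw [this]
  exact MeasurableSet.iInter fun j => MeasurableSet.iInter fun hj =>
    measurableSet_lt measurable_const (measurable_pi_apply _)

theorem measurableSet_survives (n : ℕ) : MeasurableSet (survives n) := by
  have : survives n = ⋃ (v : Label) (_ : v.length = n), {K | v ∈ treeOf K} := by
    ext K; simp [survives, and_comm]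
  rw [this]
  exact MeasurableSet.iUnion fun v => MeasurableSet.iUnion fun _ => measurableSet_mem_treeOf v

section Branching

variable {X : Type*} [MeasurableSpace X]

/-- The family indexed by labels with root entry `x.1` and with entry `x.2 (i, v)` at the vertex
`v` of the subtree above the `i`-th child of the root. -/
def glue (x : X × (ℕ × Label → X)) : Label → X
  | [] => x.1
  | i :: v => x.2 (i, v)

theorem measurable_glue : Measurable (glue : X × (ℕ × Label → X) → Label → X) := by
  refine measurable_pi_lambda _ fun v => ?_
  cases v with
  | nil => exact measurable_fst
  | cons i v => exact (measurable_pi_apply (i, v)).comp measurable_snd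

/-- The branching property: gluing independent families of entries of the subtrees and an
independent root entry yields the original product law. -/
theorem map_glue (μ : Measure X) [IsProbabilityMeasure μ] :
    (μ.prod (Measure.infinitePi fun _ : ℕ × Label => μ)).map glue =
      Measure.infinitePi fun _ : Label => μ := by
  classical
  refine Measure.eq_infinitePi _ fun s t ht => ?_
  have hinj : Function.Injective fun p : ℕ × Label => p.1 :: p.2 := by
    rintro ⟨i, v⟩ ⟨j, w⟩ h
    simpa using h
  set s' : Finset (ℕ × Label) := s.preimage (fun p => p.1 :: p.2) hinj.injOn with hs'
  have hpre : glue ⁻¹' (Set.pi s t) =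
      {x | [] ∈ s → x ∈ t []} ×ˢ Set.pi s' (fun p => t (p.1 :: p.2)) := by
    ext ⟨x, κ⟩
    simp only [mem_preimage, Set.mem_pi, mem_prod, mem_ofPred_eq, Finset.mem_coe]
    constructor
    · intro h
      exact ⟨fun h0 => h [] h0, fun p hp => h (p.1 :: p.2) (by simpa [hs'] using hp)⟩
    · rintro ⟨h0, h⟩ v hv
      cases v with
      | nil => exact h0 hv
      | cons i v => exact h (i, v) (by simpa [hs'] using hv)
  rw [Measure.map_apply measurable_glue (.pi s.countable_toSet fun i _ => ht i), hpre,
    Measure.prod_prod, Measure.infinitePi_pi _ fun _ _ => ht _]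
  have hsplit : s = (s.filter (· = [])) ∪ s'.image (fun p => p.1 :: p.2) := by
    ext v
    cases v with
    | nil => simp
    | cons i v => simp [hs']
  have hdisj : Disjoint (s.filter (· = [])) (s'.image (fun p => p.1 :: p.2)) := by
    rw [Finset.disjoint_left]
    intro v hv hv'
    obtain ⟨p, -, rfl⟩ := Finset.mem_image.1 hv'
    simp at hv
  conv_rhs => rw [hsplit]
  rw [Finset.prod_union hdisj, Finset.prod_image hinj.injOn]
  congr 1
  by_cases h0 : [] ∈ s
  · have : s.filter (· = []) = {[]} := by
      ext v; simp only [Finset.mem_filter, Finset.mem_singleton]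
      exact ⟨fun h => h.2, fun h => ⟨h ▸ h0, h⟩⟩
    rw [this]
    simp [h0]
  · have : s.filter (· = []) = ∅ := by
      ext v; simp only [Finset.mem_filter, Finset.notMem_empty, iff_false]
      rintro ⟨h, rfl⟩; exact h0 h
    rw [this]
    simp [h0]

theorem infinitePi_forall_subtree (μ : Measure X) [IsProbabilityMeasure μ]
    {C : Set (Label → X)} (hC : MeasurableSet C) (k : ℕ) :
    (Measure.infinitePi fun _ : ℕ × Label => μ) {κ | ∀ i < k, (fun v => κ (i, v)) ∈ C} =
      (Measure.infinitePi fun _ : Label => μ) C ^ k := by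
  have h := Measure.infinitePi_map_curry (fun (_ : ℕ) (_ : Label) => μ)
  have hset : {κ : ℕ × Label → X | ∀ i < k, (fun v => κ (i, v)) ∈ C} =
      MeasurableEquiv.curry ℕ Label X ⁻¹' (Set.pi (Finset.range k) fun _ => C) := by
    ext κ
    simp only [mem_ofPred_eq, mem_preimage, Set.mem_pi, Finset.coe_range, mem_Iio]
    rfl
  rw [hset, ← MeasurableEquiv.map_apply, h, Measure.infinitePi_pi _ fun _ _ => hC]
  simp

end Branching

instance (h : PMF ℕ) : IsProbabilityMeasure (gwLaw h) := by
  unfold gwLaw; infer_instance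

theorem gwLaw_compl_survives_succ (h : PMF ℕ) (n : ℕ) :
    gwLaw h (survives (n + 1))ᶜ = ∑' k, gwLaw h (survives n)ᶜ ^ k * h k := by
  have hC := (measurableSet_survives n).compl
  have hD := (measurableSet_survives (n + 1)).compl
  have hpre : glue ⁻¹' (survives (n + 1))ᶜ =
      {x : ℕ × (ℕ × Label → ℕ) | ∀ i < x.1, (fun v => x.2 (i, v)) ∈ (survives n)ᶜ} := by
    ext x
    simp only [mem_preimage, mem_compl_iff, mem_survives_succ, mem_ofPred_eq, not_exists, not_and]
    rfl
  conv_lhs => rw [gwLaw, ← map_glue]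
  rw [Measure.map_apply measurable_glue hD, Measure.prod_apply (measurable_glue hD),
    lintegral_countable']
  refine tsum_congr fun k => ?_
  rw [PMF.toMeasure_apply_singleton _ _ (measurableSet_singleton k), hpre]
  congr 1
  exact infinitePi_forall_subtree h.toMeasure hC k

/-- The probability that the Galton-Watson tree has a vertex of generation `n`. -/
noncomputable def survivalProb (h : PMF ℕ) (n : ℕ) : ℝ := (gwLaw h).real (survives n)

theorem survivalProb_zero (h : PMF ℕ) : survivalProb h 0 = 1 := by
  simp [survivalProb, survives_zero]

theorem survivalProb_nonneg (h : PMF ℕ) (n : ℕ) : 0 ≤ survivalProb h n := measureReal_nonneg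

theorem survivalProb_le_one (h : PMF ℕ) (n : ℕ) : survivalProb h n ≤ 1 := measureReal_le_one

theorem hasSum_pmf (h : PMF ℕ) : HasSum (fun k => (h k).toReal) 1 := by
  have h1 := ENNReal.summable_toReal (f := h) (by rw [h.tsum_coe]; simp)
  convert h1.hasSum using 1
  rw [← ENNReal.tsum_toReal_eq fun k => h.apply_ne_top k, h.tsum_coe]
  simp

/-- The recursion `qₙ₊₁ = 1 - f(1 - qₙ)` for the survival probabilities, with `f` the generating
function of `h`. -/
theorem survivalProb_succ (h : PMF ℕ) (n : ℕ) :
    HasSum (fun k => (h k).toReal * (1 - (1 - survivalProb h n) ^ k))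
      (survivalProb h (n + 1)) := by
  have hc : ∀ n, ((gwLaw h) (survives n)ᶜ).toReal = 1 - survivalProb h n := fun n =>
    probReal_compl_eq_one_sub (measurableSet_survives n)
  have hs : Summable fun k => (h k).toReal * (1 - survivalProb h n) ^ k := by
    refine (hasSum_pmf h).summable.of_nonneg_of_le (fun k => ?_) fun k => ?_
    · have := survivalProb_le_one h n
      have : 0 ≤ 1 - survivalProb h n := by linarith
      positivity
    · refine mul_le_of_le_one_right ENNReal.toReal_nonneg (pow_le_one₀ ?_ ?_)
      · linarith [survivalProb_le_one h n]
      · linarith [survivalProb_nonneg h n]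
  have htsum : ∑' k, (h k).toReal * (1 - survivalProb h n) ^ k = 1 - survivalProb h (n + 1) := by
    rw [← hc (n + 1), gwLaw_compl_survives_succ, ENNReal.tsum_toReal_eq]
    · refine tsum_congr fun k => ?_
      rw [ENNReal.toReal_mul, ENNReal.toReal_pow, hc, mul_comm]
    · exact fun k => ENNReal.mul_ne_top (ENNReal.pow_ne_top (measure_ne_top _ _))
        (h.apply_ne_top k)
  have := (hasSum_pmf h).sub hs.hasSum
  rw [htsum, sub_sub_cancel] at this
  simpa only [mul_sub, mul_one] using this

/-- A second-order counterpart of Bernoulli's inequality. -/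
theorem one_sub_pow_le {s : ℝ} (h0 : 0 ≤ s) (h1 : s ≤ 1) (k : ℕ) :
    (1 - s) ^ k ≤ 1 - k * s + (k : ℝ) ^ 2 * s ^ 2 := by
  induction k with
  | zero => simp
  | succ k ih =>
    have h := mul_le_mul_of_nonneg_left ih (sub_nonneg.2 h1)
    rw [pow_succ']
    push_cast
    have h3 : 0 ≤ (k : ℝ) ^ 2 * s ^ 3 := by positivity
    have h4 : 0 ≤ (k + 1 : ℝ) * s ^ 2 := by positivity
    nlinarith

/-- A sequence with `m qₙ - C qₙ² ≤ qₙ₊₁ ≤ m qₙ` decays exactly like `mⁿ`: the relative errors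
`C qₙ / m` are at most `C mⁿ / m`, which is summable, so `qₙ / mⁿ` stays away from `0`. -/
theorem exists_tendsto_div_pow {m C : ℝ} (hm0 : 0 < m) (hm1 : m < 1) (hC : 0 ≤ C) {q : ℕ → ℝ}
    (hq : ∀ n, 0 < q n) (hq0 : q 0 = 1) (hup : ∀ n, q (n + 1) ≤ m * q n)
    (hlow : ∀ n, m * q n - C * q n ^ 2 ≤ q (n + 1)) :
    ∃ r > 0, Tendsto (fun n => q n / m ^ n) atTop (𝓝 r) := by
  set r : ℕ → ℝ := fun n => q n / m ^ n with hr
  have hrpos : ∀ n, 0 < r n := fun n => div_pos (hq n) (pow_pos hm0 n)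
  have hqr : ∀ n, q n = r n * m ^ n := fun n => (div_mul_cancel₀ _ (pow_pos hm0 n).ne').symm
  have hanti : Antitone r := antitone_nat_of_succ_le fun n => by
    rw [hr]
    simp only
    rw [div_le_div_iff₀ (pow_pos hm0 _) (pow_pos hm0 _), pow_succ]
    nlinarith [hup n, pow_pos hm0 n]
  have hr1 : ∀ n, r n ≤ 1 := fun n => by
    have := hanti (Nat.zero_le n)
    simpa [hr, hq0] using this
  have hstep : ∀ n, r n - r n * (C / m * m ^ n) ≤ r (n + 1) := by
    intro n
    have h1 := hlow n
    rw [hqr n, hqr (n + 1), pow_succ m] at h1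
    have hp : 0 < m ^ n * m := mul_pos (pow_pos hm0 n) hm0
    have h2 : r n ^ 2 ≤ r n := by nlinarith [hrpos n, hr1 n]
    have h3 : C * (r n * m ^ n) ^ 2 ≤ r n * (C / m * m ^ n) * (m ^ n * m) := by
      have : r n * (C / m * m ^ n) * (m ^ n * m) = C * (r n * (m ^ n) ^ 2) := by
        field_simp
      rw [this, mul_pow]
      exact mul_le_mul_of_nonneg_left (mul_le_mul_of_nonneg_right h2 (sq_nonneg _)) hC
    refine le_of_mul_le_mul_right ?_ hp
    nlinarith
  obtain ⟨N, hN⟩ : ∃ N, C / m * (m ^ N / (1 - m)) ≤ 1 / 2 := by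
    have : Tendsto (fun N : ℕ => C / m * (m ^ N / (1 - m))) atTop (𝓝 (C / m * (0 / (1 - m)))) :=
      ((tendsto_pow_atTop_nhds_zero_of_lt_one hm0.le hm1).div_const _).const_mul _
    rw [zero_div, mul_zero] at this
    exact (this.eventually (ge_mem_nhds (by norm_num : (0 : ℝ) < 1 / 2))).exists
  have hlowN : ∀ j, r N * (1 - C / m * (m ^ N * ∑ i ∈ Finset.range j, m ^ i)) ≤ r (N + j) := by
    intro j
    induction j with
    | zero => simp
    | succ j ih =>
      have h1 := hstep (N + j)
      have h2 : r (N + j) * (C / m * m ^ (N + j)) ≤ r N * (C / m * m ^ (N + j)) :=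
        mul_le_mul_of_nonneg_right (hanti (Nat.le_add_right _ _)) (by positivity)
      rw [← add_assoc, Finset.sum_range_succ]
      calc _ = r N * (1 - C / m * (m ^ N * ∑ i ∈ Finset.range j, m ^ i)) -
            r N * (C / m * m ^ (N + j)) := by rw [pow_add]; ring
        _ ≤ r (N + j + 1) := by linarith
  have hhalf : ∀ j, r N / 2 ≤ r (N + j) := by
    intro j
    refine le_trans ?_ (hlowN j)
    have hsum : ∑ i ∈ Finset.range j, m ^ i ≤ 1 / (1 - m) := by
      have := (summable_geometric_of_lt_one hm0.le hm1).sum_le_tsum (Finset.range j)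
        (fun i _ => (pow_pos hm0 i).le)
      rwa [tsum_geometric_of_lt_one hm0.le hm1, ← one_div] at this
    have h1 : C / m * (m ^ N * ∑ i ∈ Finset.range j, m ^ i) ≤ 1 / 2 := by
      refine le_trans ?_ hN
      rw [← mul_one_div (m ^ N)]
      gcongr
    nlinarith [hrpos N]
  have hbdd : BddBelow (range r) := ⟨0, by rintro _ ⟨n, rfl⟩; exact (hrpos n).le⟩
  have hlim := tendsto_atTop_ciInf hanti hbdd
  refine ⟨_, ?_, hlim⟩
  refine (half_pos (hrpos N)).trans_le (ge_of_tendsto hlim ?_)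
  filter_upwards [eventually_ge_atTop N] with n hn
  obtain ⟨j, rfl⟩ := Nat.exists_eq_add_of_le hn
  exact hhalf j

theorem hasSum_offspringMean {h : PMF ℕ} (hm : offspringMean h ≠ ⊤) :
    HasSum (fun k : ℕ => (k : ℝ) * (h k).toReal) (offspringMean h).toReal := by
  have h1 := ENNReal.summable_toReal hm
  have h2 := h1.hasSum
  rw [← ENNReal.tsum_toReal_eq fun k => ENNReal.mul_ne_top (by simp) (h.apply_ne_top k)] at h2
  simpa [offspringMean] using h2

theorem summable_sq_of_exp_tail {h : PMF ℕ}
    (htail : ∃ c : ℝ, 0 < c ∧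
      ∀ k : ℕ, ∑' l : ℕ, h (k + l) ≤ ENNReal.ofReal (Real.exp (-(c * k)))) :
    Summable fun k : ℕ => (k : ℝ) ^ 2 * (h k).toReal := by
  obtain ⟨c, hc, htail⟩ := htail
  have hle : ∀ k, (h k).toReal ≤ Real.exp (-c) ^ k := by
    intro k
    refine ENNReal.toReal_le_of_le_ofReal (by positivity) ?_
    rw [← Real.exp_nat_mul, mul_neg, mul_comm]
    exact (by simpa using ENNReal.le_tsum (f := fun l => h (k + l)) 0 :
      h k ≤ ∑' l, h (k + l)).trans (htail k)
  have hr : ‖Real.exp (-c)‖ < 1 := by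
    rw [Real.norm_eq_abs, abs_of_pos (Real.exp_pos _)]
    exact Real.exp_lt_one_iff.2 (by linarith)
  refine (summable_pow_mul_geometric_of_norm_lt_one 2 hr).of_nonneg_of_le (fun k => by positivity)
    fun k => mul_le_mul_of_nonneg_left (hle k) (by positivity)

theorem survivalProb_tendsto {h : PMF ℕ} (hm_pos : 0 < offspringMean h)
    (hm_lt : offspringMean h < 1)
    (hsq : Summable fun k : ℕ => (k : ℝ) ^ 2 * (h k).toReal) :
    ∃ r > 0, Tendsto (fun n => survivalProb h n / (offspringMean h).toReal ^ n) atTop (𝓝 r) := by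
  have hm_top : offspringMean h ≠ ⊤ := (hm_lt.trans ENNReal.one_lt_top).ne
  have hmean := hasSum_offspringMean hm_top
  have hm0 : 0 < (offspringMean h).toReal := ENNReal.toReal_pos hm_pos.ne' hm_top
  have hm1 : (offspringMean h).toReal < 1 := by
    simpa using (ENNReal.toReal_lt_toReal hm_top ENNReal.one_ne_top).2 hm_lt
  obtain ⟨k₀, hk₀, hhk₀⟩ : ∃ k₀, k₀ ≠ 0 ∧ 0 < (h k₀).toReal := by
    have : ∃ k : ℕ, (k : ENNReal) * h k ≠ 0 := by
      by_contra! hcon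
      exact hm_pos.ne' (ENNReal.tsum_eq_zero.2 hcon)
    obtain ⟨k, hk⟩ := this
    refine ⟨k, fun h0 => hk (by simp [h0]), ?_⟩
    exact ENNReal.toReal_pos (right_ne_zero_of_mul hk) (h.apply_ne_top k)
  have hterm : ∀ n k, 0 ≤ (h k).toReal * (1 - (1 - survivalProb h n) ^ k) := fun n k =>
    mul_nonneg ENNReal.toReal_nonneg (sub_nonneg.2 (pow_le_one₀
      (by linarith [survivalProb_le_one h n]) (by linarith [survivalProb_nonneg h n])))
  refine exists_tendsto_div_pow hm0 hm1 (tsum_nonneg fun k => by positivity) ?_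
    (survivalProb_zero h) (fun n => ?_) (fun n => ?_) (C := ∑' k : ℕ, (k : ℝ) ^ 2 * (h k).toReal)
  · intro n
    induction n with
    | zero => rw [survivalProb_zero]; exact one_pos
    | succ n ih =>
      refine lt_of_lt_of_le (mul_pos hhk₀ ?_)
        (le_hasSum (survivalProb_succ h n) k₀ fun k _ => hterm n k)
      exact sub_pos.2 (pow_lt_one₀ (by linarith [survivalProb_le_one h n]) (by linarith) hk₀)
  · refine hasSum_le (fun k => ?_) (survivalProb_succ h n) (hmean.mul_right _)
    have := one_add_mul_le_pow (a := -survivalProb h n)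
      (by linarith [survivalProb_le_one h n]) k
    rw [← sub_eq_add_neg] at this
    have h2 : 1 - (1 - survivalProb h n) ^ k ≤ k * survivalProb h n := by linarith
    calc _ ≤ (h k).toReal * (k * survivalProb h n) :=
          mul_le_mul_of_nonneg_left h2 ENNReal.toReal_nonneg
      _ = _ := by ring
  · refine hasSum_le (fun k => ?_) ((hmean.mul_right _).sub (hsq.hasSum.mul_right _))
      (survivalProb_succ h n)
    have := one_sub_pow_le (survivalProb_nonneg h n) (survivalProb_le_one h n) k
    calc _ = (h k).toReal * (k * survivalProb h n - (k : ℝ) ^ 2 * survivalProb h n ^ 2) := by ring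
      _ ≤ _ := mul_le_mul_of_nonneg_left (by linarith) ENNReal.toReal_nonneg

theorem gwLaw_depth_eq (h : PMF ℕ) (n : ℕ) :
    (gwLaw h).real {K | depth (treeOf K) = n} = survivalProb h n - survivalProb h (n + 1) := by
  have : {K : Label → ℕ | depth (treeOf K) = n} = survives n \ survives (n + 1) := by
    ext K; exact depth_eq_iff
  rw [this, measureReal_sdiff (survives_succ_subset n) (measurableSet_survives _)]
  rfl

/-! ### The weight of the base vertex -/

/-- The probability that the product of `n` independent `ν`-distributed factors exceeds `u`. -/
noncomputable def prodTail (ν : Measure ℝ) [IsProbabilityMeasure ν] (n : ℕ) (u : ℝ) : ℝ :=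
  (Measure.infinitePi fun _ : ℕ => ν).real {y | u < ∏ j ∈ Finset.range n, y j}

section Weight

variable (ν : Measure ℝ) [IsProbabilityMeasure ν]

theorem measurable_vertexWeight (v : Label) :
    Measurable fun β : Label → ℝ => vertexWeight β v :=
  Finset.measurable_prod _ fun _ _ => measurable_pi_apply _

theorem measurable_prod_range (n : ℕ) :
    Measurable fun y : ℕ → ℝ => ∏ j ∈ Finset.range n, y j := by
  fun_prop

/-- The weight of a fixed vertex is a product of i.i.d. factors, one for each edge of its path. -/
theorem measure_vertexWeight (v : Label) (u : ℝ) :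
    (Measure.infinitePi fun _ : Label => ν).real {β | u < vertexWeight β v} =
      prodTail ν v.length u := by
  -- the labels on the path to `v`, continued injectively beyond `v`
  set f : ℕ → Label := fun j => (v ++ List.replicate (j + 1) 0).take (j + 1) with hf
  have hlen : ∀ j, (f j).length = j + 1 := fun j => by simp [hf]
  have hinj : Function.Injective f := fun i j hij => by
    have := congrArg List.length hij
    rw [hlen, hlen] at this
    omega
  have hfv : ∀ j < v.length, f j = v.take (j + 1) := fun j hj => by
    rw [hf]
    exact List.take_append_of_le_length (by omega)
  have hmap := Measure.map_infinitePi_infinitePi_of_inj (P := fun _ : Label => ν) hinj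
  rw [prodTail, ← hmap, map_measureReal_apply
    (measurable_pi_lambda _ fun j => measurable_pi_apply (f j))
    (measurableSet_lt measurable_const (measurable_prod_range _))]
  congr 1
  ext β
  simp only [mem_ofPred_eq, mem_preimage, vertexWeight]
  rw [Finset.prod_congr rfl fun j hj => (congrArg β (hfv j (Finset.mem_range.1 hj))).symm]

theorem prodTail_nonneg (n : ℕ) (u : ℝ) : 0 ≤ prodTail ν n u := measureReal_nonneg

theorem prodTail_le_one (n : ℕ) (u : ℝ) : prodTail ν n u ≤ 1 := measureReal_le_one

theorem prodTail_antitone (n : ℕ) : Antitone (prodTail ν n) := fun _ _ huv =>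
  measureReal_mono fun _ hy => lt_of_le_of_lt huv hy

theorem prodTail_zero (u : ℝ) : prodTail ν 0 u = if u < 1 then 1 else 0 := by
  split_ifs with hu <;> simp [prodTail, hu]

variable {ν}

theorem prodTail_succ (hpos : ∀ᵐ y ∂ν, 0 < y) (n : ℕ) (u : ℝ) :
    prodTail ν (n + 1) u = ∫ y, prodTail ν n (u / y) ∂ν := by
  set P := Measure.infinitePi fun _ : ℕ => ν with hP
  have hind : ProbabilityTheory.iIndepFun (fun (i : ℕ) (ω : ℕ → ℝ) => ω i) P :=
    ProbabilityTheory.iIndepFun_infinitePi (X := fun _ x => x) (fun _ => measurable_id)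
  have h2 := (hind.indepFun_prod_range_succ (fun i => measurable_pi_apply i) n).symm
  have hm : Measurable (∏ j ∈ Finset.range n, fun ω : ℕ → ℝ => ω j) := by
    simpa only [Finset.prod_fn] using measurable_prod_range n
  have hlaw := (ProbabilityTheory.indepFun_iff_map_prod_eq_prod_map_map
    (measurable_pi_apply n).aemeasurable hm.aemeasurable).1 h2
  rw [hP, Measure.infinitePi_map_eval, ← hP] at hlaw
  have hA : MeasurableSet {p : ℝ × ℝ | u < p.2 * p.1} :=
    measurableSet_lt measurable_const (measurable_snd.mul measurable_fst)
  have hmp : Measurable fun ω : ℕ → ℝ => (ω n, (∏ j ∈ Finset.range n, fun ω : ℕ → ℝ => ω j) ω) :=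
    (measurable_pi_apply n).prodMk hm
  have hpr : IsProbabilityMeasure (P.map (∏ j ∈ Finset.range n, fun ω : ℕ → ℝ => ω j)) :=
    Measure.isProbabilityMeasure_map hm.aemeasurable
  have h3 : prodTail ν (n + 1) u =
      (ν.prod (P.map (∏ j ∈ Finset.range n, fun ω : ℕ → ℝ => ω j))).real
        {p : ℝ × ℝ | u < p.2 * p.1} := by
    rw [← hlaw, map_measureReal_apply hmp hA, prodTail]
    congr 1
    ext ω
    simp [Finset.prod_range_succ, Finset.prod_apply]
  rw [h3, measureReal_def, Measure.prod_apply hA, ← integral_toReal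
    (measurable_measure_prodMk_left hA).aemeasurable (Eventually.of_forall fun y =>
      measure_lt_top _ _)]
  refine integral_congr_ae ?_
  filter_upwards [hpos] with y hy
  rw [← measureReal_def, map_measureReal_apply hm (measurable_prodMk_left hA), prodTail]
  congr 1
  ext ω
  simp only [mem_preimage, mem_ofPred_eq, Finset.prod_apply]
  rw [div_lt_iff₀ hy]

end Weight

section Base

theorem finite_treeOf_level (n : ℕ) :
    ∀ K : Label → ℕ, {v ∈ treeOf K | v.length = n}.Finite := by
  induction n with
  | zero =>
    intro K
    refine (finite_singleton []).subset ?_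
    rintro v ⟨-, hv⟩
    exact List.length_eq_zero_iff.1 hv
  | succ n ih =>
    intro K
    refine ((finite_lt_nat (K [])).biUnion fun i _ =>
      (ih fun w => K (i :: w)).image (List.cons i)).subset ?_
    rintro v ⟨hv, hl⟩
    cases v with
    | nil => simp at hl
    | cons i v =>
      obtain ⟨h1, h2⟩ := cons_mem_treeOf.1 hv
      exact mem_biUnion h1 ⟨v, ⟨h2, by simpa using hl⟩, rfl⟩

theorem finite_treeOf {n : ℕ} {K : Label → ℕ} (hK : K ∉ survives n) : (treeOf K).Finite := by
  refine ((finite_lt_nat n).biUnion fun j _ => finite_treeOf_level j K).subset fun v hv => ?_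
  exact mem_biUnion (not_le.1 fun h => hK (exists_mem_treeOf_length hv h) : v.length < n)
    ⟨hv, rfl⟩

theorem vBase_eq {T : Set Label} {v : Label} (hv : IsBase T v) : vBase T = v := by
  have h : ∃ v, IsBase T v := ⟨v, hv⟩
  rw [vBase, dif_pos h]
  exact h.choose_spec.unique hv

theorem exists_isBase {n : ℕ} {K : Label → ℕ} (hK : K ∉ survives n) :
    ∃ v, IsBase (treeOf K) v :=
  IsBase.exists_of_finite (finite_treeOf hK) ⟨[], nil_mem_treeOf K⟩

theorem depth_eq_iff_exists_isBase {n : ℕ} {K : Label → ℕ} :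
    depth (treeOf K) = n ↔ ∃ v, v.length = n ∧ IsBase (treeOf K) v := by
  rw [depth_eq_iff]
  constructor
  · rintro ⟨⟨w, hw, hl⟩, h2⟩
    obtain ⟨v, hv⟩ := exists_isBase h2
    refine ⟨v, le_antisymm ?_ (hl ▸ hv.2.1 w hw), hv⟩
    by_contra h
    exact h2 (exists_mem_treeOf_length hv.1 (by omega))
  · rintro ⟨v, hl, hv⟩
    refine ⟨⟨v, hv.1, hl⟩, ?_⟩
    rintro ⟨w, hw, hwl⟩
    have := hv.2.1 w hw
    omega

theorem measurableSet_isBase (v : Label) :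
    MeasurableSet {K : Label → ℕ | IsBase (treeOf K) v} := by
  have : {K : Label → ℕ | IsBase (treeOf K) v} = {K | v ∈ treeOf K} ∩
      ⋂ (w : Label) (_ : ¬ (w.length ≤ v.length ∧ (w.length = v.length → v ≤ w))),
        {K | w ∈ treeOf K}ᶜ := by
    ext K
    simp only [IsBase, mem_ofPred_eq, mem_inter_iff, mem_iInter, mem_compl_iff]
    refine and_congr_right fun _ => ⟨fun h w hw hmem => hw ⟨h.1 w hmem, h.2 w hmem⟩, fun h => ?_⟩
    exact ⟨fun w hw => (not_not.1 fun hn => h w hn hw).1,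
      fun w hw => (not_not.1 fun hn => h w hn hw).2⟩
  rw [this]
  exact (measurableSet_mem_treeOf v).inter (MeasurableSet.iInter fun w =>
    MeasurableSet.iInter fun _ => (measurableSet_mem_treeOf w).compl)

theorem gwLaw_depth_eq_tsum (h : PMF ℕ) (n : ℕ) :
    gwLaw h {K | depth (treeOf K) = n} =
      ∑' v : {v : Label // v.length = n}, gwLaw h {K | IsBase (treeOf K) v} := by
  rw [← measure_iUnion (f := fun v : {v : Label // v.length = n} =>
    {K | IsBase (treeOf K) v}) ?_ fun v => measurableSet_isBase v.1]
  · congr 1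
    ext K
    simp [depth_eq_iff_exists_isBase]
  · intro v w hvw
    refine disjoint_left.2 fun K hv hw => hvw (Subtype.ext (IsBase.unique hv hw))

theorem ae_exists_notMem_survives {h : PMF ℕ}
    (hlim : Tendsto (survivalProb h) atTop (𝓝 0)) : ∀ᵐ K ∂gwLaw h, ∃ n, K ∉ survives n := by
  have hz : (gwLaw h).real (⋂ n, survives n) ≤ 0 :=
    ge_of_tendsto' hlim fun n => measureReal_mono (iInter_subset _ n)
  have hz' : gwLaw h (⋂ n, survives n) = 0 := by
    rw [← measureReal_eq_zero_iff]
    exact le_antisymm hz measureReal_nonneg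
  rw [ae_iff]
  convert hz' using 2
  ext K
  simp

/-- The tail of the weight of the base vertex, by conditioning on the offspring numbers: up to a null
set, the event is the disjoint union over `v` of the rectangles on which `v` is the base vertex and
the weight of `v` exceeds `u`. -/
theorem biasedGWLaw_vBase {h : PMF ℕ} (hlim : Tendsto (survivalProb h) atTop (𝓝 0))
    (ν : Measure ℝ) [IsProbabilityMeasure ν] (u : ℝ) :
    HasSum (fun n : ℕ => (gwLaw h).real {K | depth (treeOf K) = n} * prodTail ν n u)
      ((biasedGWLaw h ν).real {x | u < vertexWeight x.2 (vBase (treeOf x.1))}) := by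
  set ρ := Measure.infinitePi fun _ : Label => ν with hρ
  set R : Label → Set ((Label → ℕ) × (Label → ℝ)) := fun v =>
    {K | IsBase (treeOf K) v} ×ˢ {β | u < vertexWeight β v} with hR
  have hae : ({x | u < vertexWeight x.2 (vBase (treeOf x.1))} :
      Set ((Label → ℕ) × (Label → ℝ))) =ᵐ[biasedGWLaw h ν] ⋃ v, R v := by
    have h1 : ∀ᵐ x ∂(gwLaw h).prod ρ, ∃ n, x.1 ∉ survives n :=
      Measure.quasiMeasurePreserving_fst.ae (ae_exists_notMem_survives hlim)
    filter_upwards [h1] with x ⟨n, hn⟩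
    obtain ⟨v, hv⟩ := exists_isBase hn
    refine propext ⟨fun hx => mem_iUnion.2 ⟨v, hv, ?_⟩, fun hx => ?_⟩
    · have hx' : u < vertexWeight x.2 (vBase (treeOf x.1)) := hx
      rwa [vBase_eq hv] at hx'
    · obtain ⟨w, hw1, hw2⟩ := mem_iUnion.1 hx
      change u < vertexWeight x.2 (vBase (treeOf x.1))
      rwa [vBase_eq hw1]
  have hsum : biasedGWLaw h ν {x | u < vertexWeight x.2 (vBase (treeOf x.1))} =
      ∑' n : ℕ, gwLaw h {K | depth (treeOf K) = n} * ENNReal.ofReal (prodTail ν n u) := by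
    rw [measure_congr hae, measure_iUnion]
    · rw [← (Equiv.sigmaFiberEquiv (List.length : Label → ℕ)).tsum_eq, ENNReal.tsum_sigma']
      refine tsum_congr fun n => ?_
      rw [gwLaw_depth_eq_tsum, ← ENNReal.tsum_mul_right]
      refine tsum_congr fun v => ?_
      have e : (Equiv.sigmaFiberEquiv (List.length : Label → ℕ)) ⟨n, v⟩ = v.1 := rfl
      rw [e, hR, biasedGWLaw, Measure.prod_prod]
      congr 1
      have := measure_vertexWeight ν v.1 u
      rw [v.2] at this
      rw [← this, ofReal_measureReal]
    · intro v w hvw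
      refine disjoint_left.2 fun x hv hw => hvw (IsBase.unique hv.1 hw.1)
    · exact fun v => (measurableSet_isBase v).prod
        (measurableSet_lt measurable_const (measurable_vertexWeight v))
  have hne : ∑' n : ℕ, gwLaw h {K | depth (treeOf K) = n} *
      ENNReal.ofReal (prodTail ν n u) ≠ ⊤ := by
    rw [← hsum]
    have : IsProbabilityMeasure (biasedGWLaw h ν) := by unfold biasedGWLaw; infer_instance
    exact measure_ne_top _ _
  have h2 := (ENNReal.summable_toReal hne).hasSum
  rw [← ENNReal.tsum_toReal_eq fun n => ENNReal.mul_ne_top (measure_ne_top _ _)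
    ENNReal.ofReal_ne_top, ← hsum] at h2
  simpa only [measureReal_def, ENNReal.toReal_mul,
    ENNReal.toReal_ofReal (prodTail_nonneg ν _ u)] using h2

end Base

/-! ### The weighted sum of product tails -/

section Tilting

variable {ν : Measure ℝ} {q Q m χ : ℝ}

theorem measurable_tilt (m χ : ℝ) : Measurable fun y : ℝ => ENNReal.ofReal (m * y ^ χ) :=
  ((measurable_id.pow_const χ).const_mul m).ennreal_ofReal

variable (ν m χ) in
/-- The law of `log y` under the probability measure `m * y ^ χ * ν(dy)`. -/
noncomputable def tiltedLog : Measure ℝ :=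
  (ν.withDensity fun y => ENNReal.ofReal (m * y ^ χ)).map Real.log

theorem integral_tiltedLog (hm0 : 0 < m) (hq : 1 < q) (hae : ∀ᵐ y ∂ν, y ∈ Icc q Q)
    {g : ℝ → ℝ} (hg : Measurable g) :
    ∫ x, g x ∂tiltedLog ν m χ = ∫ y, m * y ^ χ * g (Real.log y) ∂ν := by
  rw [tiltedLog, integral_map Real.measurable_log.aemeasurable hg.aestronglyMeasurable,
    integral_withDensity_eq_integral_toReal_smul
      (measurable_tilt m χ) (Eventually.of_forall fun _ => ENNReal.ofReal_lt_top)]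
  refine integral_congr_ae (hae.mono fun y hy => ?_)
  have hy0 : 0 ≤ y := by linarith [hy.1]
  simp only [smul_eq_mul]
  rw [ENNReal.toReal_ofReal (mul_nonneg hm0.le (Real.rpow_nonneg hy0 χ))]

theorem ae_tiltedLog (hq : 1 < q) (hae : ∀ᵐ y ∂ν, y ∈ Icc q Q) :
    ∀ᵐ x ∂tiltedLog ν m χ, x ∈ Icc (Real.log q) (Real.log Q) := by
  rw [tiltedLog]
  refine (ae_map_iff Real.measurable_log.aemeasurable measurableSet_Icc).2 ?_
  refine (withDensity_absolutelyContinuous ν _).ae_le (hae.mono fun y hy => ?_)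
  exact ⟨Real.log_le_log (by linarith) hy.1, Real.log_le_log (by linarith [hy.1]) hy.2⟩

theorem tiltedLog_ball_pos (hm0 : 0 < m) (hq : 1 < q) (hsupp : ν.support ⊆ Icc q Q)
    (hae : ∀ᵐ y ∂ν, y ∈ Icc q Q) {x : ℝ} (hx : x ∈ Real.log '' ν.support) {δ : ℝ} (hδ : 0 < δ) :
    0 < tiltedLog ν m χ (Metric.ball x δ) := by
  obtain ⟨y, hy, rfl⟩ := hx
  have hy0 : 0 < y := by linarith [(hsupp hy).1]
  rw [tiltedLog, Measure.map_apply Real.measurable_log measurableSet_ball, pos_iff_ne_zero]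
  intro h0
  have hac : ν ≪ ν.withDensity fun y => ENNReal.ofReal (m * y ^ χ) :=
    withDensity_absolutelyContinuous'
      (measurable_tilt m χ).aemeasurable
      (hae.mono fun z hz => by
        have hz0 : 0 < z := by linarith [hz.1]
        simpa using mul_pos hm0 (Real.rpow_pos_of_pos hz0 χ))
  have hnhds : Real.log ⁻¹' Metric.ball (Real.log y) δ ∈ 𝓝 y :=
    (Real.continuousAt_log hy0.ne').preimage_mem_nhds (Metric.ball_mem_nhds _ hδ)
  exact (Measure.mem_support_iff_forall y |>.1 hy _ hnhds).ne' (hac h0)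

variable [IsProbabilityMeasure ν]

theorem integrable_rpow (hq : 1 < q) (hae : ∀ᵐ y ∂ν, y ∈ Icc q Q) {c : ℝ} (hc : 0 ≤ c) :
    Integrable (fun y => y ^ c) ν :=
  Integrable.of_bound (measurable_id.pow_const c).aestronglyMeasurable (Q ^ c) (hae.mono
    fun y hy => by
      have hy0 : 0 ≤ y := by linarith [hy.1]
      rw [Real.norm_eq_abs, abs_of_nonneg (Real.rpow_nonneg hy0 c)]
      exact Real.rpow_le_rpow hy0 hy.2 hc)

theorem rpow_le_integral_rpow (hq : 1 < q) (hae : ∀ᵐ y ∂ν, y ∈ Icc q Q) {c : ℝ} (hc : 0 ≤ c) :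
    q ^ c ≤ ∫ y, y ^ c ∂ν := by
  calc q ^ c = ∫ _, q ^ c ∂ν := by simp
    _ ≤ _ := integral_mono_ae (integrable_const _) (integrable_rpow hq hae hc) (hae.mono
      fun y hy => Real.rpow_le_rpow (by linarith) hy.1 hc)

theorem integral_rpow_lt (hq : 1 < q) (hae : ∀ᵐ y ∂ν, y ∈ Icc q Q) {c c' : ℝ} (hc : 0 ≤ c)
    (hcc : c < c') : ∫ y, y ^ c ∂ν < ∫ y, y ^ c' ∂ν := by
  have hpos : 0 < ∫ y, y ^ c ∂ν :=
    lt_of_lt_of_le (Real.rpow_pos_of_pos (by linarith) _) (rpow_le_integral_rpow hq hae hc)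
  calc ∫ y, y ^ c ∂ν < q ^ (c' - c) * ∫ y, y ^ c ∂ν :=
        lt_mul_of_one_lt_left hpos (Real.one_lt_rpow hq (by linarith))
    _ = ∫ y, q ^ (c' - c) * y ^ c ∂ν := (integral_const_mul _ _).symm
    _ ≤ ∫ y, y ^ c' ∂ν := by
      refine integral_mono_ae ((integrable_rpow hq hae hc).const_mul _)
        (integrable_rpow hq hae (hc.trans hcc.le)) (hae.mono fun y hy => ?_)
      have hy0 : 0 < y := by linarith [hy.1]
      calc q ^ (c' - c) * y ^ c ≤ y ^ (c' - c) * y ^ c :=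
            mul_le_mul_of_nonneg_right (Real.rpow_le_rpow (by linarith) hy.1 (by linarith))
              (Real.rpow_nonneg hy0.le _)
        _ = y ^ c' := by rw [← Real.rpow_add hy0]; ring_nf

theorem exists_integral_rpow_eq (hq : 1 < q) (hae : ∀ᵐ y ∂ν, y ∈ Icc q Q) (hm0 : 0 < m)
    (hm1 : m < 1) : ∃ χ : ℝ, 0 < χ ∧ ∫ y, y ^ χ ∂ν = 1 / m := by
  obtain ⟨c, hc0, hc⟩ : ∃ c : ℝ, 0 ≤ c ∧ 1 / m ≤ ∫ y, y ^ c ∂ν := by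
    obtain ⟨n, hn⟩ := pow_unbounded_of_one_lt (1 / m) hq
    refine ⟨n, n.cast_nonneg, hn.le.trans ?_⟩
    rw [← Real.rpow_natCast]
    exact rpow_le_integral_rpow hq hae n.cast_nonneg
  have hcont : ContinuousOn (fun χ : ℝ => ∫ y, y ^ χ ∂ν) (Icc 0 c) := by
    refine continuousOn_of_dominated (bound := fun _ => Q ^ c)
      (fun χ _ => (measurable_id.pow_const χ).aestronglyMeasurable) (fun χ hχ => ?_)
      (integrable_const _) ?_
    · filter_upwards [hae] with y hy
      have hy1 : 1 ≤ y := by linarith [hy.1]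
      rw [Real.norm_eq_abs, abs_of_nonneg (Real.rpow_nonneg (by linarith) χ)]
      exact (Real.rpow_le_rpow_of_exponent_le hy1 hχ.2).trans
        (Real.rpow_le_rpow (by linarith) hy.2 hc0)
    · filter_upwards [hae] with y hy
      exact (Real.continuous_const_rpow (by linarith [hy.1])).continuousOn
  have h1m : 1 < 1 / m := by rwa [lt_div_iff₀ hm0, one_mul]
  obtain ⟨χ, hχ, hχe⟩ := intermediate_value_Icc hc0 hcont
    (show 1 / m ∈ Icc _ _ from ⟨by simpa using h1m.le, hc⟩)
  refine ⟨χ, lt_of_le_of_ne hχ.1 ?_, hχe⟩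
  rintro rfl
  simp only [Real.rpow_zero, integral_const, probReal_univ, smul_eq_mul, one_mul] at hχe
  exact h1m.ne hχe

theorem isProbabilityMeasure_tiltedLog (hm0 : 0 < m) (hχ0 : 0 ≤ χ) (hq : 1 < q)
    (hae : ∀ᵐ y ∂ν, y ∈ Icc q Q) (hχ : ∫ y, y ^ χ ∂ν = 1 / m) :
    IsProbabilityMeasure (tiltedLog ν m χ) := by
  have : IsProbabilityMeasure (ν.withDensity fun y => ENNReal.ofReal (m * y ^ χ)) := by
    constructor
    rw [withDensity_apply _ MeasurableSet.univ, Measure.restrict_univ,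
      ← ofReal_integral_eq_lintegral_ofReal ((integrable_rpow hq hae hχ0).const_mul m)
        (hae.mono fun y hy => mul_nonneg hm0.le (Real.rpow_nonneg (by linarith [hy.1]) χ)),
      integral_const_mul, hχ, mul_one_div_cancel hm0.ne', ENNReal.ofReal_one]
  exact Measure.isProbabilityMeasure_map Real.measurable_log.aemeasurable

end Tilting

section Weighted

variable {ν : Measure ℝ} [IsProbabilityMeasure ν] {q Q m χ : ℝ}

theorem prodTail_eq_one (hae : ∀ᵐ y ∂ν, 1 ≤ y) (n : ℕ) {u : ℝ} (hu0 : 0 ≤ u) (hu : u < 1) :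
    prodTail ν n u = 1 := by
  induction n generalizing u with
  | zero => rw [prodTail_zero, if_pos hu]
  | succ n ih =>
    rw [prodTail_succ (hae.mono fun y hy => by linarith)]
    rw [integral_congr_ae (g := fun _ => (1 : ℝ)) (hae.mono fun y hy => ?_)]
    · simp
    · exact ih (div_nonneg hu0 (by linarith)) ((div_le_self hu0 hy).trans_lt hu)

theorem prodTail_eq_zero (hae : ∀ᵐ y ∂ν, 0 < y ∧ y ≤ Q) (n : ℕ) {u : ℝ} (hu : Q ^ n ≤ u) :
    prodTail ν n u = 0 := by
  induction n generalizing u with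
  | zero => rw [prodTail_zero, if_neg (by simpa using hu)]
  | succ n ih =>
    rw [prodTail_succ (hae.mono fun y hy => hy.1)]
    rw [integral_congr_ae (g := fun _ => (0 : ℝ)) (hae.mono fun y hy => ?_)]
    · simp
    · have hQ : 0 < Q := hy.1.trans_le hy.2
      refine ih ?_
      rw [le_div_iff₀ hy.1]
      calc Q ^ n * y ≤ Q ^ n * Q := mul_le_mul_of_nonneg_left hy.2 (pow_pos hQ n).le
        _ ≤ u := by rwa [← pow_succ]

variable (ν m) in
/-- The sum `∑ₙ mⁿ P(Y₁ ⋯ Yₙ > exp t)`, where the `Yᵢ` are independent with law `ν`. -/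
noncomputable def geomTail (t : ℝ) : ℝ := ∑' n : ℕ, m ^ n * prodTail ν n (Real.exp t)

theorem summable_geomTail (hm0 : 0 < m) (hm1 : m < 1) (t : ℝ) :
    Summable fun n : ℕ => m ^ n * prodTail ν n (Real.exp t) :=
  (summable_geometric_of_lt_one hm0.le hm1).of_nonneg_of_le
    (fun n => mul_nonneg (pow_pos hm0 n).le (prodTail_nonneg ν n _))
    (fun n => mul_le_of_le_one_right (pow_pos hm0 n).le (prodTail_le_one ν n _))

theorem geomTail_nonneg (hm0 : 0 < m) (t : ℝ) : 0 ≤ geomTail ν m t :=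
  tsum_nonneg fun n => mul_nonneg (pow_pos hm0 n).le (prodTail_nonneg ν n _)

theorem geomTail_antitone (hm0 : 0 < m) (hm1 : m < 1) : Antitone (geomTail ν m) := fun s t hst =>
  (summable_geomTail hm0 hm1 t).tsum_le_tsum (fun n => mul_le_mul_of_nonneg_left
    (prodTail_antitone ν n (Real.exp_le_exp.2 hst)) (pow_pos hm0 n).le)
    (summable_geomTail hm0 hm1 s)

theorem geomTail_of_neg (hm0 : 0 < m) (hm1 : m < 1) (hae : ∀ᵐ y ∂ν, 1 ≤ y) {t : ℝ} (ht : t < 0) :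
    geomTail ν m t = (1 - m)⁻¹ := by
  rw [geomTail, ← tsum_geometric_of_lt_one hm0.le hm1]
  refine tsum_congr fun n => ?_
  rw [prodTail_eq_one hae n (Real.exp_pos t).le (Real.exp_lt_one_iff.2 ht), mul_one]

/-- Conditioning on one factor; for `t ≥ 0` the empty product does not contribute. -/
theorem geomTail_eq_integral (hm0 : 0 < m) (hm1 : m < 1) (hae : ∀ᵐ y ∂ν, 0 < y) {t : ℝ}
    (ht : 0 ≤ t) : geomTail ν m t = ∫ y, m * geomTail ν m (t - Real.log y) ∂ν := by
  have hmeas : ∀ n : ℕ, Measurable fun y : ℝ =>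
      m ^ (n + 1) * prodTail ν n (Real.exp (t - Real.log y)) := fun n =>
    ((prodTail_antitone ν n).measurable.comp
      (Real.measurable_exp.comp (Real.measurable_log.const_sub t))).const_mul _
  have hbd : ∀ (n : ℕ) (y : ℝ), ‖m ^ (n + 1) * prodTail ν n (Real.exp (t - Real.log y))‖
      ≤ m ^ (n + 1) := fun n y => by
    rw [Real.norm_eq_abs, abs_of_nonneg (mul_nonneg (pow_pos hm0 _).le (prodTail_nonneg ν n _))]
    exact mul_le_of_le_one_right (pow_pos hm0 _).le (prodTail_le_one ν n _)
  have hint : ∀ n : ℕ, Integrable (fun y : ℝ =>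
      m ^ (n + 1) * prodTail ν n (Real.exp (t - Real.log y))) ν := fun n =>
    Integrable.of_bound (hmeas n).aestronglyMeasurable _ (Eventually.of_forall (hbd n))
  have hsum : Summable fun n : ℕ =>
      ∫ y, ‖m ^ (n + 1) * prodTail ν n (Real.exp (t - Real.log y))‖ ∂ν := by
    refine ((summable_nat_add_iff 1).2 (summable_geometric_of_lt_one hm0.le hm1)).of_nonneg_of_le
      (fun n => integral_nonneg fun y => norm_nonneg _) (fun n => ?_)
    calc _ ≤ ∫ _, m ^ (n + 1) ∂ν := integral_mono (hint n).norm (integrable_const _) (hbd n)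
      _ = m ^ (n + 1) := by simp
  have h0 : prodTail ν 0 (Real.exp t) = 0 := by
    rw [prodTail_zero, if_neg (not_lt.2 (Real.one_le_exp ht))]
  calc geomTail ν m t = ∑' n : ℕ, m ^ (n + 1) * prodTail ν (n + 1) (Real.exp t) := by
        rw [geomTail, (summable_geomTail hm0 hm1 t).tsum_eq_zero_add, h0]
        simp
    _ = ∑' n : ℕ, ∫ y, m ^ (n + 1) * prodTail ν n (Real.exp (t - Real.log y)) ∂ν := by
        refine tsum_congr fun n => ?_
        rw [prodTail_succ hae, ← integral_const_mul]
        refine integral_congr_ae (hae.mono fun y hy => ?_)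
        simp only
        rw [Real.exp_sub, Real.exp_log hy]
    _ = ∫ y, ∑' n : ℕ, m ^ (n + 1) * prodTail ν n (Real.exp (t - Real.log y)) ∂ν :=
        integral_tsum_of_summable_integral_norm hint hsum
    _ = _ := by
        refine integral_congr_ae (Eventually.of_forall fun y => ?_)
        simp only [geomTail]
        rw [← tsum_mul_left]
        exact tsum_congr fun n => by ring

theorem geomTail_tendsto (hm0 : 0 < m) (hm1 : m < 1) (hχ0 : 0 < χ) (hq : 1 < q)
    (hsupp : ν.support ⊆ Icc q Q) (hae : ∀ᵐ y ∂ν, y ∈ Icc q Q)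
    (hlattice : Dense (AddSubgroup.closure (Real.log '' ν.support) : Set ℝ))
    (hχ : ∫ y, y ^ χ ∂ν = 1 / m) :
    Tendsto (fun t => Real.exp (χ * t) * geomTail ν m t) atTop
      (𝓝 (1 / (χ * m * ∫ y, y ^ χ * Real.log y ∂ν))) := by
  have hprob := isProbabilityMeasure_tiltedLog hm0 hχ0.le hq hae hχ
  have hFae := ae_tiltedLog (m := m) (χ := χ) hq hae
  have ha : 0 < Real.log q := Real.log_pos hq
  have hae0 : ∀ᵐ y ∂ν, 0 < y := hae.mono fun y hy => by linarith [hy.1]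
  have hae1 : ∀ᵐ y ∂ν, 1 ≤ y := hae.mono fun y hy => by linarith [hy.1]
  have hm1' : 0 < 1 - m := by linarith
  have hZm : Measurable fun t => Real.exp (χ * t) * geomTail ν m t :=
    (Real.measurable_exp.comp (measurable_id.const_mul χ)).mul
      (geomTail_antitone hm0 hm1).measurable
  have key := renewal_tendsto (F := tiltedLog ν m χ) (a := Real.log q) (b := Real.log Q)
    (Z := fun t => Real.exp (χ * t) * geomTail ν m t) (B := (1 - m)⁻¹) hχ0.le ha hFae hZm
    (fun t => mul_nonneg (Real.exp_pos _).le (geomTail_nonneg hm0 t))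
    (fun t ht => by
      rw [geomTail_of_neg hm0 hm1 hae1 ht]
      exact mul_le_of_le_one_left (inv_pos.2 hm1').le
        (Real.exp_le_one_iff.2 (mul_nonpos_of_nonneg_of_nonpos hχ0.le ht.le)))
    (fun t s hs => by
      rw [← mul_assoc, ← Real.exp_add, mul_add, add_comm (χ * s)]
      exact mul_le_mul_of_nonneg_left (geomTail_antitone hm0 hm1 (by linarith))
        (Real.exp_pos _).le)
    (fun t ht => by
      rw [integral_tiltedLog hm0 hq hae
        (g := fun x => Real.exp (χ * (t - x)) * geomTail ν m (t - x))
        (hZm.comp (measurable_id.const_sub t)), geomTail_eq_integral hm0 hm1 hae0 ht,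
        ← integral_const_mul]
      refine integral_congr_ae (hae0.mono fun y hy => ?_)
      simp only
      rw [mul_sub, Real.exp_sub, Real.rpow_def_of_pos hy, mul_comm (Real.log y)]
      field_simp)
    (S := Real.log '' ν.support)
    (by
      rintro _ ⟨y, hy, rfl⟩
      exact Real.log_pos (hq.trans_le (hsupp hy).1))
    (fun x hx δ hδ => tiltedLog_ball_pos hm0 hq hsupp hae hx hδ) hlattice
  have hmean : ∫ x, x ∂tiltedLog ν m χ = m * ∫ y, y ^ χ * Real.log y ∂ν := by
    rw [integral_tiltedLog hm0 hq hae (g := fun x => x) measurable_id, ← integral_const_mul]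
    exact integral_congr_ae (Eventually.of_forall fun y => by simp only; ring)
  have hexp : ∫ x, Real.exp (-(χ * x)) ∂tiltedLog ν m χ = m := by
    rw [integral_tiltedLog hm0 hq hae (by fun_prop)]
    calc _ = ∫ _, m ∂ν := integral_congr_ae (hae0.mono fun y hy => by
            simp only
            rw [Real.rpow_def_of_pos hy, mul_comm (Real.log y), mul_assoc, ← Real.exp_add]
            simp)
      _ = m := by simp
  -- for negative `s` the function `geomTail ν m` is constant, which gives the limit explicitly
  have hinner : ∀ᵐ x ∂tiltedLog ν m χ,
      (∫ s in (-x)..0, Real.exp (χ * s) * geomTail ν m s) =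
        (χ * (1 - m))⁻¹ * (1 - Real.exp (-(χ * x))) := by
    filter_upwards [hFae] with x hx
    have hx0 : 0 ≤ x := ha.le.trans hx.1
    have h1 : (∫ s in (-x)..0, Real.exp (χ * s) * geomTail ν m s) =
        ∫ s in (-x)..0, Real.exp (χ * s) * (1 - m)⁻¹ := by
      refine intervalIntegral.integral_congr_ae ?_
      filter_upwards [Measure.ae_ne volume (0 : ℝ)] with s hs0 hs
      rw [uIoc_of_le (by linarith)] at hs
      rw [geomTail_of_neg hm0 hm1 hae1 (lt_of_le_of_ne hs.2 hs0)]
    rw [h1, intervalIntegral.integral_mul_const,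
      intervalIntegral.integral_comp_mul_left (fun s => Real.exp s) hχ0.ne', integral_exp]
    simp only [mul_zero, Real.exp_zero, mul_neg, smul_eq_mul, mul_inv]
    ring
  rw [integral_congr_ae hinner, integral_const_mul, integral_sub (integrable_const _) ?_, hexp,
    hmean] at key
  · convert key using 2
    simp only [integral_const, probReal_univ, one_smul]
    field_simp
  · refine Integrable.of_bound (Measurable.aestronglyMeasurable (by fun_prop)) 1
      (hFae.mono fun x hx => ?_)
    rw [Real.norm_eq_abs, abs_of_pos (Real.exp_pos _)]
    exact Real.exp_le_one_iff.2 (by nlinarith [hx.1])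

/-- Weights asymptotic to `α mⁿ` lead to the same asymptotics as the weights `α mⁿ` themselves: for
`exp t ≥ Q ^ N` the terms with `n < N` vanish. -/
theorem weighted_sum_tendsto (hm0 : 0 < m) (hm1 : m < 1) (hQ : 1 ≤ Q)
    (hae : ∀ᵐ y ∂ν, 0 < y ∧ y ≤ Q) {L α : ℝ}
    (hL : Tendsto (fun t => Real.exp (χ * t) * geomTail ν m t) atTop (𝓝 L)) {p : ℕ → ℝ}
    (hp : Tendsto (fun n => (m ^ n)⁻¹ * p n) atTop (𝓝 α)) {A : ℝ → ℝ}
    (hA : ∀ u, HasSum (fun n => p n * prodTail ν n u) (A u)) :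
    Tendsto (fun t => Real.exp (χ * t) * A (Real.exp t)) atTop (𝓝 (α * L)) := by
  have hlo : (fun t => Real.exp (χ * t) * A (Real.exp t) -
      α * (Real.exp (χ * t) * geomTail ν m t)) =o[atTop]
      fun t => Real.exp (χ * t) * geomTail ν m t := by
    refine Asymptotics.isLittleO_iff.2 fun ε hε => ?_
    obtain ⟨N, hN⟩ := eventually_atTop.1 (Metric.tendsto_nhds.1 hp ε hε)
    filter_upwards [eventually_ge_atTop (Real.log (Q ^ N))] with t ht
    have hQN : Q ^ N ≤ Real.exp t := by
      rwa [← Real.log_le_iff_le_exp (pow_pos (by linarith) N)]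
    have h1 := (hA (Real.exp t)).sub ((summable_geomTail (ν := ν) hm0 hm1 t).hasSum.mul_left α)
    have h2 := (summable_geomTail (ν := ν) hm0 hm1 t).hasSum.mul_left ε
    have h3 := tsum_of_norm_bounded h2 (f := fun n => p n * prodTail ν n (Real.exp t) -
      α * (m ^ n * prodTail ν n (Real.exp t))) fun n => by
        rcases lt_or_ge n N with hn | hn
        · rw [prodTail_eq_zero hae n ((pow_le_pow_right₀ hQ hn.le).trans hQN)]
          simp
        · have h4 := (hN n hn).le
          have hmn := pow_pos hm0 n
          have e : p n * prodTail ν n (Real.exp t) - α * (m ^ n * prodTail ν n (Real.exp t)) =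
              ((m ^ n)⁻¹ * p n - α) * (m ^ n * prodTail ν n (Real.exp t)) := by
            field_simp
          rw [e, norm_mul, Real.norm_of_nonneg (mul_nonneg hmn.le (prodTail_nonneg ν n _))]
          exact mul_le_mul_of_nonneg_right h4 (mul_nonneg hmn.le (prodTail_nonneg ν n _))
    rw [h1.tsum_eq] at h3
    rw [Real.norm_of_nonneg (mul_nonneg (Real.exp_pos _).le (geomTail_nonneg hm0 t))]
    calc _ = Real.exp (χ * t) * ‖A (Real.exp t) - α * geomTail ν m t‖ := by
          rw [← Real.norm_of_nonneg (Real.exp_pos (χ * t)).le, ← norm_mul,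
            Real.norm_of_nonneg (Real.exp_pos (χ * t)).le]
          congr 1
          ring
      _ ≤ Real.exp (χ * t) * (ε * geomTail ν m t) :=
          mul_le_mul_of_nonneg_left h3 (Real.exp_pos _).le
      _ = _ := by ring
  have h0 := (hlo.trans_isBigO (hL.isBigO_one ℝ)).tendsto_div_nhds_zero
  simp only [div_one] at h0
  simpa using h0.add (hL.const_mul α)

end Weighted

/-! ### Asymptotics of the weight of the base vertex -/

theorem integral_rpow_mul_log_pos {ν : Measure ℝ} [IsProbabilityMeasure ν] {q Q χ : ℝ}
    (hq : 1 < q) (hae : ∀ᵐ y ∂ν, y ∈ Icc q Q) (hχ : 0 ≤ χ) :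
    0 < ∫ y, y ^ χ * Real.log y ∂ν := by
  have hlog : 0 < Real.log q := Real.log_pos hq
  have hint : Integrable (fun y => y ^ χ * Real.log y) ν := by
    refine (integrable_rpow hq hae hχ).mul_bdd (c := Real.log Q)
      Real.measurable_log.aestronglyMeasurable (hae.mono fun y hy => ?_)
    rw [Real.norm_of_nonneg (Real.log_nonneg (by linarith [hy.1]))]
    exact Real.log_le_log (by linarith [hy.1]) hy.2
  calc 0 < Real.log q := hlog
    _ = ∫ _, Real.log q ∂ν := by simp
    _ ≤ _ := integral_mono_ae (integrable_const _) hint (hae.mono fun y hy => ?_)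
  have h1 : Real.log q ≤ Real.log y := Real.log_le_log (by linarith) hy.1
  exact h1.trans (le_mul_of_one_le_left (hlog.le.trans h1)
    (Real.one_le_rpow (by linarith [hy.1]) hχ))

theorem theorem5 (h : PMF ℕ) (ν : Measure ℝ) [IsProbabilityMeasure ν]
    -- the offspring law is subcritical, not concentrated at `0`, and has an exponential tail
    (hm_pos : 0 < offspringMean h) (hm_lt : offspringMean h < 1)
    (htail : ∃ c : ℝ, 0 < c ∧ ∀ k : ℕ, ∑' l : ℕ, h (k + l) ≤ ENNReal.ofReal (Real.exp (-(c * k))))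
    -- the bias law has support in `[q, Q]`, and the support of its logarithm is non-lattice
    (q Q : ℝ) (hq : 1 < q) (hqQ : q < Q) (hsupp : ν.support ⊆ Set.Icc q Q)
    (hlattice : Dense (AddSubgroup.closure (Real.log '' ν.support) : Set ℝ)) :
    ∃ χ : ℝ,
      -- `χ` is the unique positive solution of the equation that defines it
      (0 < χ ∧ ∫ y in Set.Ioi (1 : ℝ), y ^ χ ∂ν = 1 / (offspringMean h).toReal) ∧
      (∀ χ' : ℝ, 0 < χ' → ∫ y in Set.Ioi (1 : ℝ), y ^ χ' ∂ν = 1 / (offspringMean h).toReal →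
        χ' = χ) ∧
      ∃ α : ℝ, 0 < α ∧
        Tendsto (fun n : ℕ => ((offspringMean h).toReal ^ n)⁻¹ *
          (gwLaw h).real {K | depth (treeOf K) = n}) atTop (𝓝 α) ∧
        Tendsto (fun u : ℝ =>
          (biasedGWLaw h ν).real {x | u < vertexWeight x.2 (vBase (treeOf x.1))} /
            (α / (χ * (offspringMean h).toReal *
                ∫ y in Set.Ioi (1 : ℝ), y ^ χ * Real.log y ∂ν) * u ^ (-χ)))
          atTop (𝓝 1) := by
  have hm_top : offspringMean h ≠ ⊤ := (hm_lt.trans ENNReal.one_lt_top).ne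
  have hm0 : 0 < (offspringMean h).toReal := ENNReal.toReal_pos hm_pos.ne' hm_top
  have hm1 : (offspringMean h).toReal < 1 := by
    simpa using (ENNReal.toReal_lt_toReal hm_top ENNReal.one_ne_top).2 hm_lt
  have hae : ∀ᵐ y ∂ν, y ∈ Icc q Q := by
    filter_upwards [Measure.support_mem_ae (μ := ν)] with y hy using hsupp hy
  -- the integrals over `(1, ∞)` in the statement are integrals over the whole line
  have hrestrict : ν.restrict (Ioi 1) = ν :=
    Measure.restrict_eq_self_of_ae_mem (hae.mono fun y hy => hq.trans_le hy.1)
  rw [hrestrict]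
  obtain ⟨χ, hχ0, hχ⟩ := exists_integral_rpow_eq hq hae hm0 hm1
  refine ⟨χ, ⟨hχ0, hχ⟩, fun χ' hχ'0 hχ' => ?_, ?_⟩
  · rcases lt_trichotomy χ' χ with hlt | heq | hlt
    · exact absurd (hχ'.trans hχ.symm) (integral_rpow_lt hq hae hχ'0.le hlt).ne
    · exact heq
    · exact absurd (hχ.trans hχ'.symm) (integral_rpow_lt hq hae hχ0.le hlt).ne
  obtain ⟨r, hr0, hr⟩ := survivalProb_tendsto hm_pos hm_lt (summable_sq_of_exp_tail htail)
  set m := (offspringMean h).toReal with hm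
  have hdepth : Tendsto (fun n : ℕ => (m ^ n)⁻¹ * (gwLaw h).real {K | depth (treeOf K) = n})
      atTop (𝓝 (r * (1 - m))) := by
    have h1 := hr.sub (((tendsto_add_atTop_iff_nat 1).2 hr).const_mul m)
    rw [← mul_comm r m, ← mul_one_sub] at h1
    refine h1.congr fun n => ?_
    have hmn := pow_pos hm0 n
    rw [gwLaw_depth_eq, pow_succ]
    field_simp
  have hsurv : Tendsto (survivalProb h) atTop (𝓝 0) := by
    have h1 := hr.mul (tendsto_pow_atTop_nhds_zero_of_lt_one hm0.le hm1)
    rw [mul_zero] at h1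
    exact h1.congr fun n => div_mul_cancel₀ _ (pow_pos hm0 n).ne'
  have hα : 0 < r * (1 - m) := mul_pos hr0 (by linarith)
  refine ⟨r * (1 - m), hα, hdepth, ?_⟩
  have hQ : 1 ≤ Q := by linarith
  have hlim := weighted_sum_tendsto hm0 hm1 hQ
    (hae.mono fun y hy => ⟨by linarith [hy.1], hy.2⟩)
    (geomTail_tendsto hm0 hm1 hχ0 hq hsupp hae hlattice hχ) hdepth
    (fun u => biasedGWLaw_vBase hsurv ν u)
  have hI : 0 < ∫ y, y ^ χ * Real.log y ∂ν := integral_rpow_mul_log_pos hq hae hχ0.le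
  have hlim' := (hlim.comp Real.tendsto_log_atTop).div_const
    (r * (1 - m) / (χ * m * ∫ y, y ^ χ * Real.log y ∂ν))
  rw [mul_one_div, div_self (div_pos hα (mul_pos (mul_pos hχ0 hm0) hI)).ne'] at hlim'
  refine hlim'.congr' ?_
  filter_upwards [eventually_gt_atTop 0] with u hu
  simp only [Function.comp]
  rw [Real.exp_log hu, Real.rpow_neg hu.le, Real.rpow_def_of_pos hu, mul_comm (Real.log u)]
  rw [mul_comm (Real.exp _), ← div_eq_mul_inv]
  exact (div_div_eq_mul_div _ _ _).symm
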